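/- Let $d\in\{2,3\}$, let $\Omega\subset\mathbb R^d$ be a bounded polygonal (polyhedral) domain, and let $\mathcal T_h$ be a conforming triangulation of $\Omega$ into simplices $K$ with edges (faces) $\mathcal E_h$, mesh size $h$, and shape regularity constant $\sigma$ (every $K$ contains a ball whose diameter $\rho_K$ satisfies $h_K\le\sigma\rho_K$, where $h_K$, $h_e$ are the diameters of $K$, $e$). Fix $l\ge1$ and $\eta>0$ and set $$\boldsymbol U_h=\{\boldsymbol u\in H(\mathrm{div};\Omega):\boldsymbol u|_K\in\boldsymbol U(K)\ \forall K,\ \boldsymbol u\cdot\boldsymbol n=0\text{ on }\partial\Omega\},$$ $$\boldsymbol V_{i,h}=\{\boldsymbol v\in H(\mathrm{div};\Omega):\boldsymbol v|_K\in RT_{l-1}(K)\ \forall K,\ \boldsymbol v\cdot\boldsymbol n=0\text{ on }\partial\Omega\},\qquad P_{i,h}=\{q\in L^2(\Omega):q|_K\in P_{l-1}(K)\ \forall K,\ \textstyle\int_\Omega q=0\},$$ where either $\boldsymbol U(K)=BDM_l(K)$ for all $K$ or $\boldsymbol U(K)=BDFM_l(K)$ for all $K$; $\boldsymbol V_h=\prod_{i=1}^n\boldsymbol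 V_{i,h}$, $\boldsymbol P_h=\prod_{i=1}^nP_{i,h}$. Let $n\ge1$, $\lambda,\tau,\alpha_i,K_i>0$, $c_{p_i}\ge0$, $\beta_{ij}=\beta_{ji}\ge0$ ($i\ne j$), $\beta_{ii}=\sum_{j\ne i}\beta_{ij}$, and put $R_i^{-1}=\tau^{-1}K_i^{-1}\alpha_i^2$, $\alpha_{p_i}=c_{p_i}/\alpha_i^2$, $\alpha_{ij}=\tau\beta_{ij}/(\alpha_i\alpha_j)$, $\tilde\alpha_{ii}=-\alpha_{p_i}-\alpha_{ii}$, $R^{-1}=\max_iR_i^{-1}$, $\lambda_0=\max\{1,\lambda\}$. Let $\Lambda=\Lambda_1+\Lambda_2+\Lambda_3+\Lambda_4$ be the $n\times n$ matrix for which $\Lambda_1$ has diagonal entries $\alpha_{ii}$ and off-diagonal entries $-\alpha_{ij}$, $\Lambda_2=\mathrm{diag}(\alpha_{p_i})$, $\Lambda_3=R\,I$ with $R=(R^{-1})^{-1}$, and all entries of $\Lambda_4$ are $1/\lambda_0$. On an interior $e=\partial K_1\cap\partial K_2$ with exterior unit normals $\boldsymbol n_1$, $\boldsymbol n_2$ let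 $\{\boldsymbol\tau\}=\frac12(\boldsymbol\tau|_{K_1}\boldsymbol n_1-\boldsymbol\tau|_{K_2}\boldsymbol n_2)$ and $[\boldsymbol u]=\boldsymbol u|_{K_1}-\boldsymbol u|_{K_2}$; on a boundary $e$ let $\{\boldsymbol\tau\}=\boldsymbol\tau\boldsymbol n$ and $[\boldsymbol u]=\boldsymbol u$; and let $\boldsymbol u_t=\boldsymbol u-(\boldsymbol u\cdot\boldsymbol n)\boldsymbol n$. With $(\cdot,\cdot)$ and $\|\cdot\|$ the $L^2(\Omega)$ inner product and norm, define $$a_h(\boldsymbol u,\boldsymbol w)=\sum_K\int_K\boldsymbol\epsilon(\boldsymbol u):\boldsymbol\epsilon(\boldsymbol w)-\sum_e\int_e\{\boldsymbol\epsilon(\boldsymbol u)\}\cdot[\boldsymbol w_t]-\sum_e\int_e\{\boldsymbol\epsilon(\boldsymbol w)\}\cdot[\boldsymbol u_t]+\sum_e\int_e\eta h_e^{-1}[\boldsymbol u_t]\cdot[\boldsymbol w_t],$$ $$\begin{aligned}\mathcal A_h((\boldsymbol u;\boldsymbol v;\boldsymbol p),(\boldsymbol w;\boldsymbol z;\boldsymbol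 q))={}&a_h(\boldsymbol u,\boldsymbol w)+\lambda(\mathrm{div}\,\boldsymbol u,\mathrm{div}\,\boldsymbol w)-\sum_i(p_i,\mathrm{div}\,\boldsymbol w)+\sum_i(R_i^{-1}\boldsymbol v_i,\boldsymbol z_i)-\sum_i(p_i,\mathrm{div}\,\boldsymbol z_i)\\&-\sum_i(\mathrm{div}\,\boldsymbol u,q_i)-\sum_i(\mathrm{div}\,\boldsymbol v_i,q_i)+\sum_i\tilde\alpha_{ii}(p_i,q_i)+\sum_i\sum_{j\ne i}\alpha_{ij}(p_j,q_i),\end{aligned}$$ $$\|\boldsymbol u\|_{\boldsymbol U_h}^2=\sum_K\|\nabla\boldsymbol u\|_{0,K}^2+\sum_eh_e^{-1}\|[\boldsymbol u_t]\|_{0,e}^2+\sum_Kh_K^2|\boldsymbol u|_{2,K}^2+\lambda\|\mathrm{div}\,\boldsymbol u\|^2,$$ $$\|\boldsymbol v\|_{\boldsymbol V}^2=\sum_i(R_i^{-1}\boldsymbol v_i,\boldsymbol v_i)+(\Lambda^{-1}\mathrm{Div}\,\boldsymbol v,\mathrm{Div}\,\boldsymbol v),\qquad\|\boldsymbol p\|_{\boldsymbol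 P}^2=(\Lambda\boldsymbol p,\boldsymbol p),\qquad \mathrm{Div}\,\boldsymbol v=(\mathrm{div}\,\boldsymbol v_1,\dots,\mathrm{div}\,\boldsymbol v_n)^T.$$ Then there is a constant $C_{bd}>0$, depending at most on $d$, $\Omega$, $l$, the choice of $BDM$ or $BDFM$, $\sigma$ and $\eta$ (so not on $\lambda$, $R_i^{-1}$, $\alpha_{p_i}$, $\alpha_{ij}$, the number of networks $n$, the triangulation and its mesh size $h$), such that for all $(\boldsymbol u_h;\boldsymbol v_h;\boldsymbol p_h),(\boldsymbol w_h;\boldsymbol z_h;\boldsymbol q_h)\in\boldsymbol U_h\times\boldsymbol V_h\times\boldsymbol P_h$ $$|\mathcal A_h((\boldsymbol u_h;\boldsymbol v_h;\boldsymbol p_h),(\boldsymbol w_h;\boldsymbol z_h;\boldsymbol q_h))|\le C_{bd}\,(\|\boldsymbol u_h\|_{\boldsymbol U_h}+\|\boldsymbol v_h\|_{\boldsymbol V}+\|\boldsymbol p_h\|_{\boldsymbol P})(\|\boldsymbol w_h\|_{\boldsymbol U_h}+\|\boldsymbol z_h\|_{\boldsymbol V}+\|\boldsymbol q_h\|_{\boldsymbol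 P}).$$ -/

import Mathlib

open MeasureTheory Matrix

open scoped ContDiff

noncomputable section

namespace MPET

/-- Points and vectors of `ℝ^d` with the Euclidean norm. -/
abbrev Pt (d : ℕ) := EuclideanSpace ℝ (Fin d)

/-- The scaled parameters of the `n`-network model (those obtained after division by `2μ`): the Lamé
parameter, the time step, the Biot-Willis coefficients, the hydraulic conductivities, the storage
coefficients and the network transfer coefficients (only the off-diagonal `beta i j` matter). -/
structure Params (n : ℕ) where
  lam : ℝ
  tau : ℝ
  alpha : Fin n → ℝ
  K : Fin n → ℝ
  c : Fin n → ℝ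
  beta : Fin n → Fin n → ℝ
  lam_pos : 0 < lam
  tau_pos : 0 < tau
  alpha_pos : ∀ i, 0 < alpha i
  K_pos : ∀ i, 0 < K i
  c_nonneg : ∀ i, 0 ≤ c i
  beta_nonneg : ∀ i j, 0 ≤ beta i j
  beta_symm : ∀ i j, beta i j = beta j i

namespace Params

variable {n : ℕ} (M : Params n)

/-- `R_i⁻¹ = τ⁻¹ K_i⁻¹ α_i²`. -/
def Rinv (i : Fin n) : ℝ := M.tau⁻¹ * (M.K i)⁻¹ * M.alpha i ^ 2

/-- `α_{p_i} = c_{p_i} / α_i²`. -/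
def alphaP (i : Fin n) : ℝ := M.c i / M.alpha i ^ 2

/-- The transfer coefficients with the diagonal `β_ii = ∑_{j ≠ i} β_ij`. -/
def betaFull (i j : Fin n) : ℝ :=
  if i = j then ∑ k ∈ Finset.univ.erase i, M.beta i k else M.beta i j

/-- `α_ij = τ β_ij / (α_i α_j)`. -/
def alphaNet (i j : Fin n) : ℝ := M.tau * M.betaFull i j / (M.alpha i * M.alpha j)

/-- `R⁻¹ = max {R_1⁻¹, …, R_n⁻¹}`. -/
def RinvMax [NeZero n] : ℝ := Finset.univ.sup' Finset.univ_nonempty M.Rinv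

/-- `λ₀ = max {1, λ}`. -/
def lam0 : ℝ := max 1 M.lam

def Lambda1 : Matrix (Fin n) (Fin n) ℝ :=
  Matrix.of fun i j => if i = j then M.alphaNet i i else -M.alphaNet i j

def Lambda2 : Matrix (Fin n) (Fin n) ℝ := Matrix.diagonal M.alphaP

def Lambda3 [NeZero n] : Matrix (Fin n) (Fin n) ℝ := Matrix.diagonal fun _ => (M.RinvMax)⁻¹

def Lambda4 : Matrix (Fin n) (Fin n) ℝ := Matrix.of fun _ _ => 1 / M.lam0

/-- `Λ = Λ₁ + Λ₂ + Λ₃ + Λ₄`. -/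
def Lambda [NeZero n] : Matrix (Fin n) (Fin n) ℝ :=
  M.Lambda1 + M.Lambda2 + M.Lambda3 + M.Lambda4

end Params

variable {d : ℕ}

/-! ### Weak divergence and `H(div; Ω)` -/

/-- `g` is the distributional divergence of the vector field `f` on `Ω`:
`∫_Ω f · ∇φ = - ∫_Ω g φ` for all test functions `φ`. -/
def IsWeakDiv (Ω : Set (Pt d)) (f : Pt d → Pt d) (g : Pt d → ℝ) : Prop :=
  ∀ φ : Pt d → ℝ, ContDiff ℝ ∞ φ → HasCompactSupport φ → tsupport φ ⊆ Ω →
    ∫ x in Ω, fderiv ℝ φ x (f x) = - ∫ x in Ω, g x * φ x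

/-- `f` belongs to `L²(Ω)^d` and has a distributional divergence in `L²(Ω)`. -/
def MemHDiv (Ω : Set (Pt d)) (f : Pt d → Pt d) : Prop :=
  MemLp f 2 (volume.restrict Ω) ∧ ∃ g : Pt d → ℝ, MemLp g 2 (volume.restrict Ω) ∧ IsWeakDiv Ω f g

open scoped Classical in
/-- The divergence of a field in `H(div; Ω)` (unique up to null sets; zero outside `H(div; Ω)`). -/
def weakDiv (Ω : Set (Pt d)) (f : Pt d → Pt d) : Pt d → ℝ :=
  if h : MemHDiv Ω f then h.2.choose else 0

/-! ### Simplices and triangulations -/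

/-- The closed simplex with the given vertices. -/
def hull (s : Finset (Pt d)) : Set (Pt d) := convexHull ℝ (s : Set (Pt d))

/-- The unit normal of the face `e` of the simplex `K`, exterior to `K`: the normalized component,
orthogonal to `e`, of the vector from the centroid of `K` to the centroid of `e`. -/
def normal (K e : Finset (Pt d)) : Pt d :=
  NormedSpace.normalize
    ((vectorSpan ℝ (e : Set (Pt d)))ᗮ.starProjection
      (e.centroid ℝ id - K.centroid ℝ id))

/-- The elements of the set `elems` of simplices that have the edge (or face) `e`. -/
def adjacent (elems : Finset (Finset (Pt d))) (e : Finset (Pt d)) : Set (Finset (Pt d)) :=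
  {K | K ∈ elems ∧ e ⊆ K}

open scoped Classical in
/-- All edges (or faces) of a set of `d`-simplices: the `d`-point subsets of the vertex sets. -/
def facesOf (elems : Finset (Finset (Pt d))) : Finset (Finset (Pt d)) :=
  elems.biUnion fun K => K.powersetCard d

/-- A conforming triangulation of `Ω` by `d`-simplices, each given by its set of vertices. Every
edge (or face) `e` comes with a numbering `fst e = K₁`, `snd e = K₂` of the elements it belongs to
(for a boundary edge or face only `fst e` is meaningful). -/
structure Triangulation (d : ℕ) (Ω : Set (Pt d)) where
  elems : Finset (Finset (Pt d))
  card_elem : ∀ K ∈ elems, K.card = d + 1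
  indep : ∀ K ∈ elems, AffineIndependent ℝ ((↑) : K → Pt d)
  inter : ∀ K ∈ elems, ∀ L ∈ elems,
    hull K ∩ hull L ⊆ convexHull ℝ ((K : Set (Pt d)) ∩ (L : Set (Pt d)))
  cover : interior (⋃ K ∈ elems, hull K) = Ω
  fst : Finset (Pt d) → Finset (Pt d)
  snd : Finset (Pt d) → Finset (Pt d)
  fst_mem : ∀ e ∈ facesOf elems, fst e ∈ adjacent elems e
  snd_mem : ∀ e ∈ facesOf elems, (adjacent elems e).Nontrivial →
    snd e ∈ adjacent elems e ∧ snd e ≠ fst e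

/-- A scalar function that is a polynomial on each element `K`, given by its polynomials `q|_K`
(the values at finite sets that are no elements of the triangulation play no role). -/
abbrev ScalarField (d : ℕ) := Finset (Pt d) → MvPolynomial (Fin d) ℝ

/-- A vector field that is polynomial on each element `K`, given by its restrictions `u|_K`. -/
abbrev VectorField (d : ℕ) := Finset (Pt d) → Fin d → MvPolynomial (Fin d) ℝ

/-- The value of a polynomial at a point. -/
def ev (p : MvPolynomial (Fin d) ℝ) (x : Pt d) : ℝ := MvPolynomial.eval (fun i => x i) p

/-- The value of a polynomial vector field at a point. -/
def evV (u : Fin d → MvPolynomial (Fin d) ℝ) (x : Pt d) : Pt d :=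
  WithLp.toLp 2 fun i => ev (u i) x

/-- The entry `ε(u)_ij = (∂_j u_i + ∂_i u_j) / 2` of the strain of a polynomial vector field. -/
def strain (u : Fin d → MvPolynomial (Fin d) ℝ) (i j : Fin d) : MvPolynomial (Fin d) ℝ :=
  MvPolynomial.C (1 / 2 : ℝ) * (MvPolynomial.pderiv j (u i) + MvPolynomial.pderiv i (u j))

/-- The vector `ε(u)(x) ν`. -/
def traction (u : Fin d → MvPolynomial (Fin d) ℝ) (ν x : Pt d) : Pt d :=
  WithLp.toLp 2 fun i => ∑ j, ev (strain u i j) x * ν j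

/-- The tangential component `a - (a · ν) ν`. -/
def tang (ν a : Pt d) : Pt d := a - inner ℝ a ν • ν

/-- The two choices of the local displacement space. -/
inductive Family
  | BDM
  | BDFM

/-- `u ∈ BDM_l(K) = P_l(K)^d`. -/
def IsBDM (l : ℕ) (u : Fin d → MvPolynomial (Fin d) ℝ) : Prop := ∀ i, (u i).totalDegree ≤ l

/-- `u ∈ BDFM_l(K)`: `u ∈ P_l(K)^d` and `u · n ∈ P_{l-1}(e)` on each edge (or face) `e` of `K`. -/
def IsBDFM (l : ℕ) (K : Finset (Pt d)) (u : Fin d → MvPolynomial (Fin d) ℝ) : Prop :=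
  (∀ i, (u i).totalDegree ≤ l) ∧
  ∀ e ∈ K.powersetCard d, ∃ q : MvPolynomial (Fin d) ℝ, q.totalDegree ≤ l - 1 ∧
    ∀ x ∈ hull e, inner ℝ (evV u x) (normal K e) = ev q x

/-- `u` lies in the local displacement space of degree `l ≥ 1`. -/
def Family.IsLocal (F : Family) (l : ℕ) (K : Finset (Pt d))
    (u : Fin d → MvPolynomial (Fin d) ℝ) : Prop :=
  match F with
  | .BDM => IsBDM l u
  | .BDFM => IsBDFM l K u

/-- `v ∈ RT_{l-1}(K) = P_{l-1}(K)^d + x P_{l-1}(K)`, for `l ≥ 1`. -/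
def IsRT (l : ℕ) (v : Fin d → MvPolynomial (Fin d) ℝ) : Prop :=
  ∃ (a : Fin d → MvPolynomial (Fin d) ℝ) (b : MvPolynomial (Fin d) ℝ),
    (∀ i, (a i).totalDegree ≤ l - 1) ∧ b.totalDegree ≤ l - 1 ∧
    ∀ i, v i = a i + MvPolynomial.X i * b

namespace Triangulation

variable {Ω : Set (Pt d)} (T : Triangulation d Ω)

/-- The set of all edges (or faces). -/
def faces : Finset (Finset (Pt d)) := facesOf T.elems

/-- `e` is an interior edge (or face): it belongs to two different elements. -/
def IsInterior (e : Finset (Pt d)) : Prop := (adjacent T.elems e).Nontrivial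

/-- Shape regularity with constant `σ`: every `K` contains a ball whose diameter `2 r` satisfies
`h_K ≤ σ (2 r)`. -/
def ShapeRegular (σ : ℝ) : Prop :=
  ∀ K ∈ T.elems, ∃ (x : Pt d) (r : ℝ), 0 < r ∧ Metric.closedBall x r ⊆ hull K ∧
    Metric.diam (hull K) ≤ σ * (2 * r)

/-- The function on `Ω` (defined up to a null set) with the given restrictions to the elements. -/
def glue (q : ScalarField d) (x : Pt d) : ℝ :=
  ∑ K ∈ T.elems, (interior (hull K)).indicator (ev (q K)) x

/-- The vector field on `Ω` (up to a null set) with the given restrictions to the elements. -/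
def glueV (u : VectorField d) (x : Pt d) : Pt d :=
  ∑ K ∈ T.elems, (interior (hull K)).indicator (evV (u K)) x

/-- `div u` for `u ∈ H(div; Ω)`. -/
def div (u : VectorField d) : Pt d → ℝ := weakDiv Ω (T.glueV u)

/-- `u · n = 0` on `∂Ω`. -/
def NormalVanishes (u : VectorField d) : Prop :=
  ∀ e ∈ T.faces, ¬ T.IsInterior e → ∀ x ∈ hull e,
    inner ℝ (evV (u (T.fst e)) x) (normal (T.fst e) e) = 0

/-- The displacement space `U_h`. -/
def Uh (F : Family) (l : ℕ) : Set (VectorField d) :=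
  {u | MemHDiv Ω (T.glueV u) ∧ (∀ K ∈ T.elems, F.IsLocal l K (u K)) ∧ T.NormalVanishes u}

/-- The flux space `V_{i,h}` (the same for all `i`). -/
def Vh (l : ℕ) : Set (VectorField d) :=
  {v | MemHDiv Ω (T.glueV v) ∧ (∀ K ∈ T.elems, IsRT l (v K)) ∧ T.NormalVanishes v}

/-- The pressure space `P_{i,h}` (the same for all `i`). -/
def Ph (l : ℕ) : Set (ScalarField d) :=
  {q | (∀ K ∈ T.elems, (q K).totalDegree ≤ l - 1) ∧ ∫ x in Ω, T.glue q x = 0}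

open scoped Classical in
/-- The average `{ε(u)}` on the edge (or face) `e`: `(ε(u)|_{K₁} n₁ - ε(u)|_{K₂} n₂) / 2` on an
interior one, `ε(u) n` on a boundary one. -/
def avgStrain (u : VectorField d) (e : Finset (Pt d)) (x : Pt d) : Pt d :=
  if T.IsInterior e then
    (1 / 2 : ℝ) • (traction (u (T.fst e)) (normal (T.fst e) e) x
      - traction (u (T.snd e)) (normal (T.snd e) e) x)
  else traction (u (T.fst e)) (normal (T.fst e) e) x

open scoped Classical in
/-- The jump `[u_t]` of the tangential component on the edge (or face) `e`. -/
def jumpTang (u : VectorField d) (e : Finset (Pt d)) (x : Pt d) : Pt d :=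
  if T.IsInterior e then
    tang (normal (T.fst e) e) (evV (u (T.fst e)) x)
      - tang (normal (T.snd e) e) (evV (u (T.snd e)) x)
  else tang (normal (T.fst e) e) (evV (u (T.fst e)) x)

/-- The integral over an edge (or face), with respect to length (or area). -/
def faceIntegral (e : Finset (Pt d)) (f : Pt d → ℝ) : ℝ := ∫ x in hull e, f x ∂μHE[d - 1]

/-- The bilinear form `a_h` with stabilization parameter `η`. -/
def ah (η : ℝ) (u w : VectorField d) : ℝ :=
  (∑ K ∈ T.elems, ∫ x in hull K, ∑ i, ∑ j, ev (strain (u K) i j) x * ev (strain (w K) i j) x)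
  - (∑ e ∈ T.faces, faceIntegral e fun x => inner ℝ (T.avgStrain u e x) (T.jumpTang w e x))
  - (∑ e ∈ T.faces, faceIntegral e fun x => inner ℝ (T.avgStrain w e x) (T.jumpTang u e x))
  + ∑ e ∈ T.faces, faceIntegral e fun x =>
      η * (Metric.diam (hull e))⁻¹ * inner ℝ (T.jumpTang u e x) (T.jumpTang w e x)

/-- `‖u‖²_DG`. -/
def dgNormSq (u : VectorField d) : ℝ :=
  (∑ K ∈ T.elems, ∫ x in hull K, ∑ i, ∑ j, ev (MvPolynomial.pderiv j (u K i)) x ^ 2)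
  + (∑ e ∈ T.faces,
      (Metric.diam (hull e))⁻¹ * faceIntegral e fun x => ‖T.jumpTang u e x‖ ^ 2)
  + ∑ K ∈ T.elems, Metric.diam (hull K) ^ 2 * ∫ x in hull K,
      ∑ i, ∑ j, ∑ k, ev (MvPolynomial.pderiv k (MvPolynomial.pderiv j (u K i))) x ^ 2

variable {n : ℕ} (M : Params n)

/-- `‖u‖_{U_h} = (‖u‖²_DG + λ ‖div u‖²)^{1/2}`. -/
def normU (u : VectorField d) : ℝ :=
  Real.sqrt (T.dgNormSq u + M.lam * ∫ x in Ω, T.div u x ^ 2)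

/-- `‖v‖_V = (∑_i (R_i⁻¹ v_i, v_i) + (Λ⁻¹ Div v, Div v))^{1/2}`. -/
def normV [NeZero n] (v : Fin n → VectorField d) : ℝ :=
  Real.sqrt ((∑ i, ∫ x in Ω, M.Rinv i * inner ℝ (T.glueV (v i) x) (T.glueV (v i) x))
    + ∫ x in Ω, (M.Lambda⁻¹ *ᵥ fun i => T.div (v i) x) ⬝ᵥ fun i => T.div (v i) x)

/-- `‖p‖_P = (Λ p, p)^{1/2}`. -/
def normP [NeZero n] (p : Fin n → ScalarField d) : ℝ :=
  Real.sqrt (∫ x in Ω, (M.Lambda *ᵥ fun i => T.glue (p i) x) ⬝ᵥ fun i => T.glue (p i) x)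

/-- The bilinear form `𝒜_h((u; v; p), (w; z; q))`. -/
def Ah (η : ℝ) (u : VectorField d) (v : Fin n → VectorField d) (p : Fin n → ScalarField d)
    (w : VectorField d) (z : Fin n → VectorField d) (q : Fin n → ScalarField d) : ℝ :=
  T.ah η u w
  + M.lam * (∫ x in Ω, T.div u x * T.div w x)
  - (∑ i, ∫ x in Ω, T.glue (p i) x * T.div w x)
  + (∑ i, ∫ x in Ω, M.Rinv i * inner ℝ (T.glueV (v i) x) (T.glueV (z i) x))
  - (∑ i, ∫ x in Ω, T.glue (p i) x * T.div (z i) x)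
  - (∑ i, ∫ x in Ω, T.div u x * T.glue (q i) x)
  - (∑ i, ∫ x in Ω, T.div (v i) x * T.glue (q i) x)
  + (∑ i, (-M.alphaP i - M.alphaNet i i) * ∫ x in Ω, T.glue (p i) x * T.glue (q i) x)
  + ∑ i, ∑ j ∈ Finset.univ.erase i,
      M.alphaNet i j * ∫ x in Ω, T.glue (p j) x * T.glue (q i) x

end Triangulation

end MPET

end

open MPET

noncomputable section

namespace MPET

variable {d : ℕ}

/-! ### Cauchy-Schwarz inequalities -/

/-! Each term of `Ah` is bounded by Cauchy-Schwarz with a pair of weights for which both factors are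
parts of the norms. The weights absorb all model parameters, so the constants depend only on `d`,
`l`, `σ` and `η`.

In `ah` the delicate terms pair the average strain with the tangential jump on a face. With weight
`h_e` on the strain and `h_e⁻¹` on the jump they reduce to the discrete trace inequality
`exists_trace_le`. This rests on finite dimensionality: for polynomials of degree at most `l` the
mean square over a ball controls the values on a larger concentric ball
(`exists_ev_sq_le_integral`), and shape regularity provides an inscribed ball of size comparable to
the element.

In the coupling of the pressures with `div w`, the summand `Λ₄` gives `(∑ p_i)² ≤ λ₀ Λp·p`, with no
factor `n`. What remains is `λ₀ ‖div w‖² ≤ (1 + λ) ‖div w‖²`. The part without `λ` is controlled by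
the broken gradient, because the weak divergence of a piecewise polynomial field in `H(div)` is its
piecewise divergence (`div_ae_eq`).

Pressures and flux divergences are dual through `Λ` and `Λ⁻¹`. The pressure-pressure terms form
minus the quadratic form of `Λ₁ + Λ₂`, which is semidefinite (`Λ₁` is a rescaled weighted graph
Laplacian) and dominated by `Λ`. -/

/-- The quadratic `G t² - 2 F t + K` is nonnegative for `t > 0` by hypothesis and for `t ≤ 0` by the
signs of its coefficients, so its discriminant is nonpositive. Testing only `t > 0` leaves room for
the weights `t`, `t⁻¹` in Young's inequality. -/
theorem sq_le_mul_of_forall_quadratic {F G K : ℝ} (h : ∀ t : ℝ, 0 < t → 2 * F * t ≤ G * t ^ 2 + K)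
    (hF : 0 ≤ F) (hG : 0 ≤ G) (hK : 0 ≤ K) : F ^ 2 ≤ G * K := by
  have hd : discrim G (-2 * F) K ≤ 0 := by
    refine discrim_le_zero fun t => ?_
    rcases lt_or_ge 0 t with ht | ht
    · nlinarith [h t ht]
    · nlinarith [mul_nonneg hF (neg_nonneg.2 ht), mul_nonneg hG (mul_self_nonneg t)]
  rw [discrim] at hd
  nlinarith

/-- Young's inequality `|f| ≤ (t g + t⁻¹ k) / 2` is integrated and then optimized over `t`. The
pointwise hypothesis covers scalar products, inner products and matrix forms alike, and asks no
measurability of `f`. -/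
theorem abs_integral_le_sqrt_mul_sqrt {α : Type*} [MeasurableSpace α] {μ : Measure α}
    {f g k : α → ℝ} (hg : Integrable g μ) (hk : Integrable k μ) (hg0 : ∀ x, 0 ≤ g x)
    (hk0 : ∀ x, 0 ≤ k x) (h : ∀ x, f x ^ 2 ≤ g x * k x) :
    |∫ x, f x ∂μ| ≤ √(∫ x, g x ∂μ) * √(∫ x, k x ∂μ) := by
  rw [← Real.sqrt_mul (integral_nonneg hg0)]
  refine Real.le_sqrt_of_sq_le ?_
  refine sq_le_mul_of_forall_quadratic (fun t ht => ?_) (abs_nonneg _) (integral_nonneg hg0)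
    (integral_nonneg hk0)
  have hb : ∀ x, ‖f x‖ ≤ (t * g x + t⁻¹ * k x) / 2 := fun x => by
    have h1 : f x ^ 2 ≤ ((t * g x + t⁻¹ * k x) / 2) ^ 2 := by
      refine (h x).trans ?_
      have : g x * k x = (t * g x) * (t⁻¹ * k x) := by field_simp
      rw [this]
      nlinarith [sq_nonneg (t * g x - t⁻¹ * k x)]
    have h2 : 0 ≤ (t * g x + t⁻¹ * k x) / 2 := by
      have := hg0 x; have := hk0 x; positivity
    rw [Real.norm_eq_abs]
    exact abs_le_of_sq_le_sq h1 h2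
  have hi : Integrable (fun x => (t * g x + t⁻¹ * k x) / 2) μ :=
    ((hg.const_mul t).add (hk.const_mul t⁻¹)).div_const 2
  have := norm_integral_le_of_norm_le hi (Filter.Eventually.of_forall hb)
  rw [integral_div, integral_add (hg.const_mul t) (hk.const_mul t⁻¹), integral_const_mul,
    integral_const_mul, Real.norm_eq_abs] at this
  have h3 := mul_le_mul_of_nonneg_right this ht.le
  have h4 : (t * (∫ x, g x ∂μ) + t⁻¹ * ∫ x, k x ∂μ) / 2 * t
      = (t ^ 2 * (∫ x, g x ∂μ) + ∫ x, k x ∂μ) / 2 := by field_simp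
  rw [h4] at h3
  linarith

theorem abs_sum_le_sqrt_mul_sqrt {ι : Type*} (s : Finset ι) {f g k : ι → ℝ}
    (hg : ∀ i ∈ s, 0 ≤ g i) (hk : ∀ i ∈ s, 0 ≤ k i) (h : ∀ i ∈ s, |f i| ≤ √(g i) * √(k i)) :
    |∑ i ∈ s, f i| ≤ √(∑ i ∈ s, g i) * √(∑ i ∈ s, k i) := by
  rw [← Real.sqrt_mul (Finset.sum_nonneg hg)]
  refine Real.le_sqrt_of_sq_le ?_
  rw [sq_abs]
  refine (Finset.sum_sq_le_sum_mul_sum_of_sq_le_mul s hg hk fun i hi => ?_)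
  have := pow_le_pow_left₀ (abs_nonneg _) (h i hi) 2
  rwa [sq_abs, mul_pow, Real.sq_sqrt (hg i hi), Real.sq_sqrt (hk i hi)] at this

theorem dotProduct_mulVec_sq_le {n : ℕ} {B : Matrix (Fin n) (Fin n) ℝ} (hB : B.PosSemidef)
    (x y : Fin n → ℝ) : (B *ᵥ x ⬝ᵥ y) ^ 2 ≤ (B *ᵥ x ⬝ᵥ x) * (B *ᵥ y ⬝ᵥ y) := by
  have hs : Bᵀ = B := (conjTranspose_eq_transpose_of_trivial B).symm.trans hB.1
  have h0 : ∀ z, 0 ≤ Matrix.toBilin' B z z := fun z => by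
    rw [Matrix.toBilin'_apply']; simpa using hB.dotProduct_mulVec_nonneg z
  have hsym : ∀ a b, Matrix.toBilin' B a b = Matrix.toBilin' B b a := fun a b => by
    rw [Matrix.toBilin'_apply', Matrix.toBilin'_apply', dotProduct_mulVec, ← mulVec_transpose, hs,
      dotProduct_comm]
  have := LinearMap.BilinForm.apply_sq_le_of_symm (Matrix.toBilin' B) h0 ⟨hsym⟩ x y
  simp only [Matrix.toBilin'_apply'] at this
  rwa [dotProduct_comm (B *ᵥ x) y, dotProduct_comm (B *ᵥ x) x, dotProduct_comm (B *ᵥ y) y,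
    ← Matrix.toBilin'_apply' B y x, hsym, Matrix.toBilin'_apply' B]

/-- Cauchy-Schwarz for the form of `B`, applied to `x` and `B⁻¹ y`. This is the duality between the
pressure norm and the divergence part of the flux norm. -/
theorem dotProduct_sq_le {n : ℕ} {B : Matrix (Fin n) (Fin n) ℝ} (hB : B.PosDef)
    (x y : Fin n → ℝ) : (x ⬝ᵥ y) ^ 2 ≤ (B *ᵥ x ⬝ᵥ x) * (B⁻¹ *ᵥ y ⬝ᵥ y) := by
  have hs : Bᵀ = B := (conjTranspose_eq_transpose_of_trivial B).symm.trans hB.1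
  have hu : IsUnit B.det := (Matrix.isUnit_iff_isUnit_det B).1 hB.isUnit
  have h1 : B *ᵥ (B⁻¹ *ᵥ y) = y := by rw [mulVec_mulVec, mul_nonsing_inv _ hu, one_mulVec]
  have h2 : B *ᵥ x ⬝ᵥ (B⁻¹ *ᵥ y) = x ⬝ᵥ y := by
    rw [dotProduct_comm, dotProduct_mulVec, ← mulVec_transpose, hs, h1, dotProduct_comm]
  have := dotProduct_mulVec_sq_le hB.posSemidef x (B⁻¹ *ᵥ y)
  rwa [h2, h1, dotProduct_comm y] at this

/-! ### Polynomials -/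

theorem totalDegree_pderiv_le {ι : Type*} (i : ι) (p : MvPolynomial ι ℝ) :
    (MvPolynomial.pderiv i p).totalDegree ≤ p.totalDegree := by
  classical
  conv_lhs => rw [p.as_sum, map_sum]
  refine MvPolynomial.totalDegree_finsetSum_le fun m hm => ?_
  rw [MvPolynomial.pderiv_monomial]
  refine (MvPolynomial.totalDegree_monomial_le _ _).trans ?_
  refine le_trans ?_ (MvPolynomial.le_totalDegree hm)
  exact Finsupp.degree_mono (tsub_le_self)

theorem totalDegree_aeval_le {ι κ : Type*} (f : ι → MvPolynomial κ ℝ)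
    (hf : ∀ i, (f i).totalDegree ≤ 1) (p : MvPolynomial ι ℝ) :
    (MvPolynomial.aeval f p).totalDegree ≤ p.totalDegree := by
  rw [MvPolynomial.aeval_def, MvPolynomial.eval₂_eq]
  refine MvPolynomial.totalDegree_finsetSum_le fun m hm => ?_
  refine le_trans ?_ (MvPolynomial.le_totalDegree hm)
  refine (MvPolynomial.totalDegree_mul _ _).trans ?_
  rw [MvPolynomial.algebraMap_eq, MvPolynomial.totalDegree_C, zero_add]
  refine (MvPolynomial.totalDegree_finsetProd _ _).trans (Finset.sum_le_sum fun i _ => ?_)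
  exact (MvPolynomial.totalDegree_pow _ _).trans (mul_le_of_le_one_right' (hf i))

theorem memLp_restrict_of_continuous {E : Type*} [NormedAddCommGroup E]
    {μ : Measure (Pt d)} {s : Set (Pt d)} (hs : Bornology.IsBounded s) (hm : MeasurableSet s)
    (hμ : μ s < ⊤) {f : Pt d → E} (hf : Continuous f) (p : ENNReal) :
    MemLp f p (μ.restrict s) := by
  have : IsFiniteMeasure (μ.restrict s) := ⟨by simpa using hμ⟩
  obtain ⟨B, hB⟩ := hs.isCompact_closure.exists_bound_of_continuousOn hf.continuousOn
  refine MemLp.of_bound ?_ B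
    (ae_restrict_of_forall_mem hm fun x hx => hB x (subset_closure hx))
  exact hf.aestronglyMeasurable

@[fun_prop]
theorem continuous_ev (p : MvPolynomial (Fin d) ℝ) : Continuous (ev p) :=
  p.continuous_eval.comp (by fun_prop)

@[fun_prop]
theorem continuous_evV (u : Fin d → MvPolynomial (Fin d) ℝ) : Continuous (evV u) := by
  unfold evV
  have := fun i => continuous_ev (u i)
  fun_prop

/-- Polynomials with the given coefficients. -/
def polyOfCoeffs (s : Finset (Fin d →₀ ℕ)) : (s → ℝ) →ₗ[ℝ] MvPolynomial (Fin d) ℝ :=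
  ∑ m : s, (MvPolynomial.monomial (m : Fin d →₀ ℕ)).comp (LinearMap.proj m)

theorem polyOfCoeffs_apply (s : Finset (Fin d →₀ ℕ)) (c : s → ℝ) :
    polyOfCoeffs s c = ∑ m : s, MvPolynomial.monomial (m : Fin d →₀ ℕ) (c m) := by
  simp [polyOfCoeffs]

theorem polyOfCoeffs_injective (s : Finset (Fin d →₀ ℕ)) :
    Function.Injective (polyOfCoeffs s) := by
  classical
  refine (injective_iff_map_eq_zero _).2 fun c hc => ?_
  funext m
  have := congrArg (MvPolynomial.coeff (m : Fin d →₀ ℕ)) hc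
  rw [polyOfCoeffs_apply, MvPolynomial.coeff_sum] at this
  simpa [MvPolynomial.coeff_monomial] using this

theorem exists_polyOfCoeffs (l : ℕ) : ∃ s : Finset (Fin d →₀ ℕ),
    ∀ p : MvPolynomial (Fin d) ℝ, p.totalDegree ≤ l → ∃ c : s → ℝ, polyOfCoeffs s c = p := by
  refine ⟨(Finsupp.finite_of_degree_le (σ := Fin d) l).toFinset, fun p hp =>
    ⟨fun m => p.coeff m, ?_⟩⟩
  rw [polyOfCoeffs_apply]
  rw [Finset.sum_coe_sort _ (fun m => MvPolynomial.monomial m (p.coeff m))]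
  conv_rhs => rw [p.as_sum]
  refine (Finset.sum_subset (fun m hm => ?_) fun m _ hm => ?_).symm
  · rw [Set.Finite.mem_toFinset, Set.mem_ofPred_eq]
    exact (MvPolynomial.le_totalDegree hm).trans hp
  · rw [MvPolynomial.notMem_support_iff.1 hm, MvPolynomial.monomial_zero]

/-- The Euclidean ball contains a cube, and a polynomial vanishing on a product of infinite sets is
zero. -/
theorem eq_zero_of_ev_eq_zero_ball {p : MvPolynomial (Fin d) ℝ}
    (h : ∀ x ∈ Metric.ball (0 : Pt d) 1, ev p x = 0) : p = 0 := by
  have hU : (fun x : Fin d → ℝ => WithLp.toLp 2 x) ⁻¹' Metric.ball (0 : Pt d) 1 ∈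
      nhds (0 : Fin d → ℝ) := by
    refine ContinuousAt.preimage_mem_nhds (by fun_prop) ?_
    exact Metric.ball_mem_nhds _ one_pos
  obtain ⟨ε, hε, hb⟩ := Metric.mem_nhds_iff.1 hU
  refine MvPolynomial.funext_set (fun _ => Metric.ball (0 : ℝ) ε) (fun _ => ?_) fun x hx => ?_
  · rw [Real.ball_eq_Ioo]; exact Set.Ioo_infinite (by linarith)
  · rw [map_zero]
    have hx' : x ∈ Metric.ball (0 : Fin d → ℝ) ε := by
      rw [ball_pi _ hε]; exact hx
    exact h _ (hb hx')

/-- The `L²` class, on the unit ball, of a polynomial. -/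
def polyToLp : MvPolynomial (Fin d) ℝ →ₗ[ℝ]
    Lp ℝ 2 ((volume : Measure (Pt d)).restrict (Metric.ball 0 1)) where
  toFun p := (memLp_restrict_of_continuous Metric.isBounded_ball measurableSet_ball
    measure_ball_lt_top (continuous_ev p) 2).toLp _
  map_add' p q := by
    rw [← MemLp.toLp_add]; congr 1; funext x; simp [ev]
  map_smul' c p := by
    rw [RingHom.id_apply, ← MemLp.toLp_const_smul]; congr 1; funext x; simp [ev]

theorem norm_polyToLp_sq (p : MvPolynomial (Fin d) ℝ) :
    ‖polyToLp p‖ ^ 2 = ∫ x in Metric.ball (0 : Pt d) 1, ev p x ^ 2 := by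
  rw [← real_inner_self_eq_norm_sq, L2.inner_def]
  refine integral_congr_ae ?_
  filter_upwards [MemLp.coeFn_toLp (memLp_restrict_of_continuous Metric.isBounded_ball
    measurableSet_ball measure_ball_lt_top (continuous_ev p) 2)] with x hx
  have hx' : polyToLp p x = ev p x := hx
  rw [hx', real_inner_self_eq_norm_sq, Real.norm_eq_abs, sq_abs]

theorem polyToLp_injective : Function.Injective (polyToLp (d := d)) := by
  refine (injective_iff_map_eq_zero _).2 fun p hp => ?_
  have h0 := norm_polyToLp_sq p
  rw [hp, norm_zero] at h0
  have hm := memLp_restrict_of_continuous (μ := volume) Metric.isBounded_ball measurableSet_ball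
    measure_ball_lt_top ((continuous_ev p).pow 2) 1 (s := Metric.ball (0 : Pt d) 1)
  have h1 := (integral_eq_zero_iff_of_nonneg (fun x => sq_nonneg (ev p x))
    (memLp_one_iff_integrable.1 hm)).1 (by simpa using h0.symm)
  refine eq_zero_of_ev_eq_zero_ball fun x hx => ?_
  have h2 := Measure.eqOn_open_of_ae_eq h1 Metric.isOpen_ball
    ((continuous_ev p).pow 2).continuousOn continuousOn_const hx
  simpa using h2

/-- On the finite-dimensional space of polynomials of degree at most `l` the `L²` norm over the unit
ball bounds the coefficients, and these bound the values on the ball of radius `R`. -/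
theorem exists_ev_sq_le_integral_ball (d l : ℕ) (R : ℝ) :
    ∃ C : ℝ, 0 ≤ C ∧ ∀ p : MvPolynomial (Fin d) ℝ, p.totalDegree ≤ l →
      ∀ y : Pt d, ‖y‖ ≤ R → ev p y ^ 2 ≤ C * ∫ x in Metric.ball (0 : Pt d) 1, ev p x ^ 2 := by
  obtain ⟨s, hs⟩ := exists_polyOfCoeffs (d := d) l
  -- An injective linear map on the finite-dimensional coefficient space is bounded below.
  obtain ⟨K, -, hK⟩ := (polyToLp.comp (polyOfCoeffs s)).exists_antilipschitzWith
    (LinearMap.ker_eq_bot.2 (polyToLp_injective.comp (polyOfCoeffs_injective s)))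
  have hB : ∀ m : s, ∃ B : ℝ, ∀ y : Pt d, ‖y‖ ≤ R →
      |ev (MvPolynomial.monomial (m : Fin d →₀ ℕ) 1) y| ≤ B := fun m => by
    obtain ⟨B, hB⟩ := (isCompact_closedBall (0 : Pt d) R).exists_bound_of_continuousOn
      (continuous_ev (MvPolynomial.monomial (m : Fin d →₀ ℕ) 1)).continuousOn
    exact ⟨B, fun y hy => hB y (by simpa using hy)⟩
  choose B hB using hB
  refine ⟨(∑ m, |B m|) ^ 2 * (K : ℝ) ^ 2, by positivity, fun p hp y hy => ?_⟩
  obtain ⟨c, rfl⟩ := hs p hp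
  rw [← norm_polyToLp_sq]
  have h1 : ‖c‖ ≤ K * ‖polyToLp (polyOfCoeffs s c)‖ := by
    simpa using hK.le_mul_norm_sub c 0
  have h2 : |ev (polyOfCoeffs s c) y| ≤ (∑ m, |B m|) * ‖c‖ := by
    have h3 : ev (polyOfCoeffs s c) y
        = ∑ m : s, c m * ev (MvPolynomial.monomial (m : Fin d →₀ ℕ) 1) y := by
      rw [polyOfCoeffs_apply, ev, map_sum]
      refine Finset.sum_congr rfl fun m _ => ?_
      simp [ev, MvPolynomial.eval_monomial]
    rw [h3, Finset.sum_mul]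
    refine (Finset.abs_sum_le_sum_abs _ _).trans (Finset.sum_le_sum fun m _ => ?_)
    rw [abs_mul, mul_comm]
    exact mul_le_mul ((hB m y hy).trans (le_abs_self _)) (norm_le_pi_norm c m) (abs_nonneg _)
      (abs_nonneg _)
  have h4 : |ev (polyOfCoeffs s c) y|
      ≤ (∑ m, |B m|) * (K * ‖polyToLp (polyOfCoeffs s c)‖) :=
    h2.trans (mul_le_mul_of_nonneg_left h1 (Finset.sum_nonneg fun _ _ => abs_nonneg _))
  calc ev (polyOfCoeffs s c) y ^ 2 = |ev (polyOfCoeffs s c) y| ^ 2 := (sq_abs _).symm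
    _ ≤ _ := pow_le_pow_left₀ (abs_nonneg _) h4 2
    _ = _ := by ring

theorem setIntegral_ball_comp_add_smul (f : Pt d → ℝ) (x : Pt d) {r : ℝ} (hr : 0 < r) :
    ∫ z in Metric.ball (0 : Pt d) 1, f (x + r • z)
      = (r ^ d)⁻¹ * ∫ z in Metric.ball x r, f z := by
  have h := Measure.setIntegral_comp_smul_of_pos volume (fun z => f (x + z))
    (Metric.ball (0 : Pt d) 1) hr
  rw [h, smul_unitBall_of_pos hr, finrank_euclideanSpace_fin, smul_eq_mul]
  congr 1
  have h2 := (measurePreserving_add_left (volume : Measure (Pt d)) x).setIntegral_preimage_emb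
    (measurableEmbedding_addLeft x) f (Metric.ball x r)
  rw [← h2]
  congr 2
  ext z; simp

/-- Inverse estimate for polynomials of degree at most `l`: the values on a ball of radius `R r` are
controlled by the mean square over the concentric ball of radius `r`. -/
theorem exists_ev_sq_le_integral (d l : ℕ) (R : ℝ) :
    ∃ C : ℝ, 0 ≤ C ∧ ∀ p : MvPolynomial (Fin d) ℝ, p.totalDegree ≤ l →
      ∀ (x : Pt d) (r : ℝ), 0 < r → ∀ y, dist y x ≤ R * r →
        ev p y ^ 2 ≤ C * ((r ^ d)⁻¹ * ∫ z in Metric.ball x r, ev p z ^ 2) := by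
  obtain ⟨C, hC, h⟩ := exists_ev_sq_le_integral_ball d l R
  refine ⟨C, hC, fun p hp x r hr y hy => ?_⟩
  -- The pullback `q(z) = p(x + r z)` has degree at most that of `p` and carries the estimate over
  -- from the unit ball.
  set q := MvPolynomial.aeval (fun i => MvPolynomial.C (x i) + MvPolynomial.C r * MvPolynomial.X i :
    Fin d → MvPolynomial (Fin d) ℝ) p with hq
  have hqd : q.totalDegree ≤ l := by
    refine (totalDegree_aeval_le _ (fun i => ?_) p).trans hp
    refine (MvPolynomial.totalDegree_add _ _).trans (max_le (by simp) ?_)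
    refine (MvPolynomial.totalDegree_mul _ _).trans ?_
    simp
  have hqe : ∀ z : Pt d, ev q z = ev p (x + r • z) := fun z => by
    rw [ev, hq, ← MvPolynomial.bind₁, MvPolynomial.eval, MvPolynomial.eval₂Hom_bind₁]
    change _ = MvPolynomial.eval₂Hom (RingHom.id ℝ) _ p
    congr 2
    funext i
    simp
  have hyn : ‖r⁻¹ • (y - x)‖ ≤ R := by
    rw [norm_smul, norm_inv, Real.norm_eq_abs, abs_of_pos hr, ← dist_eq_norm,
      inv_mul_le_iff₀ hr, mul_comm]
    exact hy
  have := h q hqd _ hyn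
  rw [hqe, smul_inv_smul₀ hr.ne', add_sub_cancel] at this
  simp only [hqe] at this
  rwa [setIntegral_ball_comp_add_smul (fun z => ev p z ^ 2) x hr] at this

/-- A flat `k`-dimensional set has `k`-dimensional measure at most that of a ball of radius equal to
its diameter. -/
theorem euclideanHausdorffMeasure_hull_le {e : Finset (Pt d)} {k : ℕ} (hc : e.card = k + 1)
    (he : AffineIndependent ℝ ((↑) : e → Pt d)) :
    μHE[k] (hull e) ≤ ENNReal.ofReal (Metric.diam (hull e) ^ k) *
      volume (Metric.ball (0 : Pt k) 1) := by
  have hW : Module.finrank ℝ (vectorSpan ℝ (e : Set (Pt d))) = k := by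
    have hr : ∀ s : Set (Pt d), s = Set.range ((↑) : e → Pt d) →
        Module.finrank ℝ (vectorSpan ℝ s) = k := by
      rintro _ rfl
      exact he.finrank_vectorSpan (by simpa using hc)
    exact hr _ Subtype.range_coe.symm
  obtain ⟨p, hp⟩ : e.Nonempty := Finset.card_pos.1 (by omega)
  let b := (stdOrthonormalBasis ℝ (vectorSpan ℝ (e : Set (Pt d)))).reindex (finCongr hW)
  -- An isometric parametrization of the affine span of `e`, based at the vertex `p`; the hull lies
  -- in the image of the ball whose radius is its diameter.
  let φ : Pt k → Pt d := fun z => p + (b.repr.symm z : Pt d)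
  have hφ : Isometry φ := by
    refine Isometry.of_dist_eq fun y z => ?_
    simp only [φ, dist_add_left, ← Subtype.dist_eq]
    exact b.repr.symm.dist_map y z
  have hsub : hull e ⊆ φ '' Metric.closedBall 0 (Metric.diam (hull e)) := by
    intro y hy
    have hpm : p ∈ hull e := subset_convexHull ℝ _ hp
    have hyW : y - p ∈ vectorSpan ℝ (e : Set (Pt d)) := by
      rw [← direction_affineSpan]
      exact AffineSubspace.vsub_mem_direction (convexHull_subset_affineSpan _ hy)
        (subset_affineSpan ℝ _ hp)
    refine ⟨b.repr ⟨y - p, hyW⟩, ?_, ?_⟩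
    · rw [mem_closedBall_zero_iff, LinearIsometryEquiv.norm_map, Submodule.coe_norm, ← dist_eq_norm]
      exact Metric.dist_le_diam_of_mem
        ((e.finite_toSet.isCompact_convexHull ℝ).isBounded) hy hpm
    · simp [φ]
  calc μHE[k] (hull e) ≤ μHE[k] (φ '' Metric.closedBall 0 (Metric.diam (hull e))) :=
        measure_mono hsub
    _ = volume (Metric.closedBall (0 : Pt k) (Metric.diam (hull e))) := by
        rw [hφ.euclideanHausdorffMeasure_image, EuclideanSpace.euclideanHausdorffMeasure_eq_volume]
    _ = _ := by
        rw [Measure.addHaar_closedBall _ _ Metric.diam_nonneg, finrank_euclideanSpace_fin]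

/-! ### Simplices -/

theorem isCompact_hull (K : Finset (Pt d)) : IsCompact (hull K) :=
  K.finite_toSet.isCompact_convexHull ℝ

theorem measurableSet_hull (K : Finset (Pt d)) : MeasurableSet (hull K) :=
  (isCompact_hull K).isClosed.measurableSet

theorem hull_mono {e K : Finset (Pt d)} (h : e ⊆ K) : hull e ⊆ hull K :=
  convexHull_mono (Finset.coe_subset.2 h)

theorem diam_hull_mono {e K : Finset (Pt d)} (h : e ⊆ K) :
    Metric.diam (hull e) ≤ Metric.diam (hull K) :=
  Metric.diam_mono (hull_mono h) (isCompact_hull K).isBounded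

/-- The inequality suffices for upper bounds and spares a proof that the projected vector is
nonzero, since zero normalizes to zero. -/
theorem norm_normal_le (K e : Finset (Pt d)) : ‖normal K e‖ ≤ 1 := by
  unfold normal
  by_cases h : ((vectorSpan ℝ (e : Set (Pt d)))ᗮ.starProjection
      (e.centroid ℝ id - K.centroid ℝ id)) = 0
  · rw [h, NormedSpace.normalize_zero_eq_zero, norm_zero]; exact zero_le_one
  · rw [NormedSpace.norm_normalize h]

theorem integrable_hull {K : Finset (Pt d)} {f : Pt d → ℝ} (hf : Continuous f) :
    Integrable f (volume.restrict (hull K)) :=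
  memLp_one_iff_integrable.1 (memLp_restrict_of_continuous (isCompact_hull K).isBounded
    (measurableSet_hull K) (isCompact_hull K).measure_lt_top hf 1)

theorem affineIndependent_of_subset {e K : Finset (Pt d)} (h : e ⊆ K)
    (hK : AffineIndependent ℝ ((↑) : K → Pt d)) : AffineIndependent ℝ ((↑) : e → Pt d) :=
  AffineIndependent.mono (t := (K : Set (Pt d))) (s := (e : Set (Pt d))) hK (Finset.coe_subset.2 h)

theorem face_measure_le {e : Finset (Pt d)} (hd : 1 ≤ d) (hc : e.card = d)
    (he : AffineIndependent ℝ ((↑) : e → Pt d)) :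
    μHE[d - 1] (hull e) ≤ ENNReal.ofReal (Metric.diam (hull e) ^ (d - 1)) *
      volume (Metric.ball (0 : Pt (d - 1)) 1) :=
  euclideanHausdorffMeasure_hull_le (by omega) he

theorem face_measure_lt_top {e : Finset (Pt d)} (hd : 1 ≤ d) (hc : e.card = d)
    (he : AffineIndependent ℝ ((↑) : e → Pt d)) : μHE[d - 1] (hull e) < ⊤ :=
  (face_measure_le hd hc he).trans_lt
    (ENNReal.mul_lt_top ENNReal.ofReal_lt_top measure_ball_lt_top)

theorem integrable_face {e : Finset (Pt d)} (hd : 1 ≤ d) (hc : e.card = d)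
    (he : AffineIndependent ℝ ((↑) : e → Pt d)) {f : Pt d → ℝ} (hf : Continuous f) :
    Integrable f (μHE[d - 1].restrict (hull e)) :=
  memLp_one_iff_integrable.1 (memLp_restrict_of_continuous (isCompact_hull e).isBounded
    (measurableSet_hull e) (face_measure_lt_top hd hc he) hf 1)

theorem diam_hull_pos {e : Finset (Pt d)} (hc : 2 ≤ e.card) : 0 < Metric.diam (hull e) := by
  obtain ⟨a, ha, b, hb, hab⟩ := Finset.one_lt_card.1 hc
  exact (dist_pos.2 hab).trans_le (Metric.dist_le_diam_of_mem (isCompact_hull e).isBounded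
    (subset_convexHull ℝ _ ha) (subset_convexHull ℝ _ hb))

/-- Discrete trace inequality on the faces of the shape regular simplices. -/
theorem exists_trace_le {d : ℕ} (hd : 1 ≤ d) (l : ℕ) (σ : ℝ) :
    ∃ C : ℝ, 0 ≤ C ∧ ∀ (K e : Finset (Pt d)), AffineIndependent ℝ ((↑) : K → Pt d) →
      (∃ (x : Pt d) (r : ℝ), 0 < r ∧ Metric.closedBall x r ⊆ hull K ∧
        Metric.diam (hull K) ≤ σ * (2 * r)) → e ⊆ K → e.card = d →
      ∀ p : MvPolynomial (Fin d) ℝ, p.totalDegree ≤ l →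
        Metric.diam (hull e) * ∫ x in hull e, ev p x ^ 2 ∂μHE[d - 1]
          ≤ C * ∫ x in hull K, ev p x ^ 2 := by
  -- The ratio is `2 σ` because `K` lies within distance `diam K ≤ 2 σ r` of the center of its
  -- inscribed ball.
  obtain ⟨C, hC, h⟩ := exists_ev_sq_le_integral d l (2 * σ)
  set vd : ℝ := (volume (Metric.ball (0 : Pt (d - 1)) 1)).toReal with hcd
  have hc0 : 0 ≤ vd := ENNReal.toReal_nonneg
  refine ⟨vd * C * |2 * σ| ^ d, by positivity, ?_⟩
  rintro K e hK ⟨x, r, hr, hball, hdiam⟩ heK hc p hp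
  have he := affineIndependent_of_subset heK hK
  set D := Metric.diam (hull e) with hD
  have hD0 : 0 ≤ D := Metric.diam_nonneg
  set I := ∫ x in hull K, ev p x ^ 2 with hI
  have hI0 : 0 ≤ I := integral_nonneg fun x => sq_nonneg _
  have hIb : ∫ z in Metric.ball x r, ev p z ^ 2 ≤ I :=
    setIntegral_mono_set (integrable_hull ((continuous_ev p).pow 2))
      (Filter.Eventually.of_forall fun z => sq_nonneg _)
      (Metric.ball_subset_closedBall.trans hball).eventuallyLE
  have hDr : D ≤ |2 * σ| * r := by
    refine (diam_hull_mono heK).trans (hdiam.trans ?_)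
    nlinarith [le_abs_self (2 * σ)]
  have hpt : ∀ y ∈ hull e, ‖ev p y ^ 2‖ ≤ C * ((r ^ d)⁻¹ * I) := fun y hy => by
    rw [Real.norm_eq_abs, abs_of_nonneg (sq_nonneg _)]
    refine (h p hp x r hr y ?_).trans ?_
    · refine (Metric.dist_le_diam_of_mem (isCompact_hull K).isBounded (hull_mono heK hy)
        (hball (Metric.mem_closedBall_self hr.le))).trans ?_
      linarith
    · gcongr
  have hint : ∫ x in hull e, ev p x ^ 2 ∂μHE[d - 1] ≤ C * ((r ^ d)⁻¹ * I) * (D ^ (d - 1) * vd) := by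
    have h1 := norm_setIntegral_le_of_norm_le_const (face_measure_lt_top hd hc he) hpt
    refine (le_abs_self _).trans (h1.trans ?_)
    refine mul_le_mul_of_nonneg_left ?_ (by positivity)
    rw [measureReal_def]
    refine (ENNReal.toReal_mono ?_ (face_measure_le hd hc he)).trans ?_
    · exact (ENNReal.mul_lt_top ENNReal.ofReal_lt_top measure_ball_lt_top).ne
    · rw [ENNReal.toReal_mul, ENNReal.toReal_ofReal (by positivity)]
  -- The factor `D` and the face measure, of order `D ^ (d - 1)`, combine to `D ^ d`, which the
  -- factor `r ^ d` in the denominator compensates. The absolute value in `|2 * σ|` is there because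
  -- no sign of `σ` is assumed.
  calc D * ∫ x in hull e, ev p x ^ 2 ∂μHE[d - 1]
      ≤ D * (C * ((r ^ d)⁻¹ * I) * (D ^ (d - 1) * vd)) := by gcongr
    _ = vd * C * D ^ d * ((r ^ d)⁻¹ * I) := by
        conv_rhs => rw [← Nat.sub_add_cancel hd, pow_succ]
        rw [Nat.sub_add_cancel hd]
        ring
    _ ≤ vd * C * (|2 * σ| * r) ^ d * ((r ^ d)⁻¹ * I) := by gcongr
    _ = vd * C * |2 * σ| ^ d * I := by
        rw [mul_pow]; field_simp

/-! ### Strains, tractions and jumps -/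

/-- Symmetrization does not increase the Frobenius norm: `((a + b) / 2)² ≤ (a² + b²) / 2`, and the
transposed entries have the same sum of squares. -/
theorem sum_strain_sq_le (u : Fin d → MvPolynomial (Fin d) ℝ) (x : Pt d) :
    ∑ i, ∑ j, ev (strain u i j) x ^ 2 ≤ ∑ i, ∑ j, ev (MvPolynomial.pderiv j (u i)) x ^ 2 := by
  have h : ∀ i j, ev (strain u i j) x ^ 2 ≤ (1 / 2 : ℝ) * ev (MvPolynomial.pderiv j (u i)) x ^ 2
      + (1 / 2 : ℝ) * ev (MvPolynomial.pderiv i (u j)) x ^ 2 := fun i j => by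
    have : ev (strain u i j) x = 1 / 2 * (ev (MvPolynomial.pderiv j (u i)) x
        + ev (MvPolynomial.pderiv i (u j)) x) := by simp [ev, strain]
    rw [this]
    nlinarith [sq_nonneg (ev (MvPolynomial.pderiv j (u i)) x - ev (MvPolynomial.pderiv i (u j)) x)]
  refine (Finset.sum_le_sum fun i _ => Finset.sum_le_sum fun j _ => h i j).trans ?_
  simp only [Finset.sum_add_distrib, ← Finset.mul_sum]
  rw [Finset.sum_comm (f := fun i j => ev (MvPolynomial.pderiv i (u j)) x ^ 2)]
  linarith

theorem totalDegree_strain_le {l : ℕ} {u : Fin d → MvPolynomial (Fin d) ℝ}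
    (hu : ∀ i, (u i).totalDegree ≤ l) (i j : Fin d) : (strain u i j).totalDegree ≤ l := by
  refine (MvPolynomial.totalDegree_mul _ _).trans ?_
  rw [MvPolynomial.totalDegree_C, zero_add]
  exact (MvPolynomial.totalDegree_add _ _).trans (max_le ((totalDegree_pderiv_le _ _).trans (hu i))
    ((totalDegree_pderiv_le _ _).trans (hu j)))

theorem norm_traction_sq_le (u : Fin d → MvPolynomial (Fin d) ℝ) {ν : Pt d} (hν : ‖ν‖ ≤ 1)
    (x : Pt d) : ‖traction u ν x‖ ^ 2 ≤ ∑ i, ∑ j, ev (strain u i j) x ^ 2 := by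
  rw [EuclideanSpace.real_norm_sq_eq]
  refine Finset.sum_le_sum fun i _ => ?_
  refine (Finset.sum_mul_sq_le_sq_mul_sq Finset.univ (fun j => ev (strain u i j) x) fun j => ν j).trans ?_
  rw [← EuclideanSpace.real_norm_sq_eq]
  refine mul_le_of_le_one_right (Finset.sum_nonneg fun _ _ => sq_nonneg _) ?_
  exact pow_le_one₀ (norm_nonneg _) hν

@[fun_prop]
theorem continuous_traction (u : Fin d → MvPolynomial (Fin d) ℝ) (ν : Pt d) :
    Continuous (traction u ν) := by
  unfold traction
  have := fun i j => continuous_ev (strain u i j)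
  fun_prop

namespace Triangulation
variable {Ω : Set (Pt d)} (T : Triangulation d Ω)

@[fun_prop]
theorem continuous_avgStrain (u : VectorField d) (e : Finset (Pt d)) :
    Continuous (T.avgStrain u e) := by
  unfold avgStrain
  have := fun K ν => continuous_traction (u K) ν
  by_cases h : T.IsInterior e
  · simp only [h, if_true]; fun_prop
  · simp only [h, if_false]; fun_prop

@[fun_prop]
theorem continuous_jumpTang (u : VectorField d) (e : Finset (Pt d)) :
    Continuous (T.jumpTang u e) := by
  unfold jumpTang tang
  have := fun K => continuous_evV (u K)
  by_cases h : T.IsInterior e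
  · simp only [h, if_true]; fun_prop
  · simp only [h, if_false]; fun_prop

theorem mem_faces {e : Finset (Pt d)} :
    e ∈ T.faces ↔ ∃ K ∈ T.elems, e ⊆ K ∧ e.card = d := by
  simp [faces, facesOf, Finset.mem_powersetCard]

theorem card_face {e : Finset (Pt d)} (he : e ∈ T.faces) : e.card = d := by
  obtain ⟨K, -, -, h⟩ := T.mem_faces.1 he
  exact h

theorem affineIndependent_face {e : Finset (Pt d)} (he : e ∈ T.faces) :
    AffineIndependent ℝ ((↑) : e → Pt d) := by
  obtain ⟨K, hK, h, -⟩ := T.mem_faces.1 he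
  exact affineIndependent_of_subset h (T.indep K hK)

open scoped Classical in
-- Double counting: a simplex has `d + 1` faces.
theorem sum_faces_sum_elems_le {g : Finset (Pt d) → ℝ} (hg : ∀ K ∈ T.elems, 0 ≤ g K) :
    ∑ e ∈ T.faces, ∑ K ∈ T.elems with e ⊆ K, g K ≤ (d + 1) * ∑ K ∈ T.elems, g K := by
  simp only [Finset.sum_filter]
  rw [Finset.sum_comm, Finset.mul_sum]
  refine Finset.sum_le_sum fun K hK => ?_
  rw [← Finset.sum_filter, Finset.sum_const, nsmul_eq_mul]
  refine mul_le_mul_of_nonneg_right ?_ (hg K hK)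
  have hsub : (T.faces.filter fun e => e ⊆ K) ⊆ K.powersetCard d := fun e he => by
    rw [Finset.mem_filter] at he
    exact Finset.mem_powersetCard.2 ⟨he.2, T.card_face he.1⟩
  have := Finset.card_le_card hsub
  rw [Finset.card_powersetCard, T.card_elem K hK, Nat.choose_succ_self_right] at this
  exact_mod_cast this

open scoped Classical in
/-- The strain average on a face is controlled by the strains in the adjacent elements. -/
theorem exists_avgStrain_le {d : ℕ} (hd : 1 ≤ d) (l : ℕ) (σ : ℝ) :
    ∃ C : ℝ, 0 ≤ C ∧ ∀ (Ω : Set (Pt d)) (T : Triangulation d Ω), T.ShapeRegular σ →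
      ∀ u : VectorField d, (∀ K ∈ T.elems, ∀ i, (u K i).totalDegree ≤ l) →
        ∑ e ∈ T.faces, Metric.diam (hull e) * faceIntegral e (fun x => ‖T.avgStrain u e x‖ ^ 2)
          ≤ C * ∑ K ∈ T.elems,
            ∫ x in hull K, ∑ i, ∑ j, ev (MvPolynomial.pderiv j (u K i)) x ^ 2 := by
  obtain ⟨C, hC, h⟩ := exists_trace_le hd l σ
  refine ⟨C * (d + 1), by positivity, fun Ω T hT u hu => ?_⟩
  set g : Finset (Pt d) → ℝ := fun K =>
    ∫ x in hull K, ∑ i, ∑ j, ev (MvPolynomial.pderiv j (u K i)) x ^ 2 with hg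
  have hg0 : ∀ K, 0 ≤ g K := fun K => integral_nonneg fun x =>
    Finset.sum_nonneg fun i _ => Finset.sum_nonneg fun j _ => sq_nonneg _
  -- The trace inequality is for scalar polynomials, so it is applied to each entry of the strain.
  have hε : ∀ K ∈ T.elems, ∀ e ∈ T.faces, e ⊆ K → Metric.diam (hull e) *
      ∫ x in hull e, ‖traction (u K) (normal K e) x‖ ^ 2 ∂μHE[d - 1] ≤ C * g K := by
    intro K hK e he heK
    have hint := fun {f : Pt d → ℝ} (hf : Continuous f) =>
      integrable_face hd (T.card_face he) (T.affineIndependent_face he) hf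
    calc Metric.diam (hull e) * ∫ x in hull e, ‖traction (u K) (normal K e) x‖ ^ 2 ∂μHE[d - 1]
        ≤ Metric.diam (hull e) *
          ∫ x in hull e, ∑ i, ∑ j, ev (strain (u K) i j) x ^ 2 ∂μHE[d - 1] := by
          refine mul_le_mul_of_nonneg_left ?_ Metric.diam_nonneg
          refine integral_mono (hint ((continuous_traction _ _).norm.pow 2))
            (hint (by fun_prop)) fun x => norm_traction_sq_le _ (norm_normal_le K e) x
      _ = ∑ i, ∑ j, Metric.diam (hull e) *
          ∫ x in hull e, ev (strain (u K) i j) x ^ 2 ∂μHE[d - 1] := by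
          rw [integral_finsetSum _ fun i _ => hint (by fun_prop), Finset.mul_sum]
          refine Finset.sum_congr rfl fun i _ => ?_
          rw [integral_finsetSum _ fun j _ => hint (by fun_prop), Finset.mul_sum]
      _ ≤ ∑ i, ∑ j, C * ∫ x in hull K, ev (strain (u K) i j) x ^ 2 :=
          Finset.sum_le_sum fun i _ => Finset.sum_le_sum fun j _ =>
            h K e (T.indep K hK) (hT K hK) heK (T.card_face he) _
              (totalDegree_strain_le (hu K hK) i j)
      _ = C * ∫ x in hull K, ∑ i, ∑ j, ev (strain (u K) i j) x ^ 2 := by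
          rw [integral_finsetSum _ fun i _ => integrable_hull (by fun_prop), Finset.mul_sum]
          refine Finset.sum_congr rfl fun i _ => ?_
          rw [integral_finsetSum _ fun j _ => integrable_hull (by fun_prop), Finset.mul_sum]
      _ ≤ C * g K := by
          refine mul_le_mul_of_nonneg_left ?_ hC
          exact integral_mono (integrable_hull (by fun_prop)) (integrable_hull (by fun_prop))
            fun x => sum_strain_sq_le _ x
  have hface : ∀ e ∈ T.faces, Metric.diam (hull e) *
      faceIntegral e (fun x => ‖T.avgStrain u e x‖ ^ 2) ≤ C * ∑ K ∈ T.elems with e ⊆ K, g K := by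
    intro e he
    have hfst := T.fst_mem e he
    have hsum : ∀ s : Finset (Finset (Pt d)), (∀ K ∈ s, K ∈ T.elems ∧ e ⊆ K) →
        ∑ K ∈ s, g K ≤ ∑ K ∈ T.elems with e ⊆ K, g K := fun s hs =>
      Finset.sum_le_sum_of_subset_of_nonneg (fun K hK => Finset.mem_filter.2 (hs K hK))
        fun K _ _ => hg0 K
    have hint : ∀ K, Integrable (fun x => ‖traction (u K) (normal K e) x‖ ^ 2)
        (μHE[d - 1].restrict (hull e)) := fun K =>
      integrable_face hd (T.card_face he) (T.affineIndependent_face he) (by fun_prop)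
    by_cases hi : T.IsInterior e
    · obtain ⟨hsnd, hne⟩ := T.snd_mem e he hi
      have h1 := hε _ hfst.1 e he hfst.2
      have h2 := hε _ hsnd.1 e he hsnd.2
      have h3 := hsum {T.fst e, T.snd e} (by
        intro K hK
        rw [Finset.mem_insert, Finset.mem_singleton] at hK
        rcases hK with rfl | rfl
        exacts [hfst, hsnd])
      rw [Finset.sum_pair hne.symm] at h3
      -- By the parallelogram law, `‖(a - b) / 2‖² ≤ (‖a‖² + ‖b‖²) / 2`.
      have h4 : faceIntegral e (fun x => ‖T.avgStrain u e x‖ ^ 2)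
          ≤ (∫ x in hull e, ‖traction (u (T.fst e)) (normal (T.fst e) e) x‖ ^ 2 ∂μHE[d - 1])
            + ∫ x in hull e, ‖traction (u (T.snd e)) (normal (T.snd e) e) x‖ ^ 2 ∂μHE[d - 1] := by
        rw [← integral_add (hint _) (hint _)]
        refine integral_mono (integrable_face hd (T.card_face he) (T.affineIndependent_face he)
          ((T.continuous_avgStrain u e).norm.pow 2)) ((hint _).add (hint _)) fun x => ?_
        simp only [avgStrain, hi, if_true, norm_smul, mul_pow]
        set a := traction (u (T.fst e)) (normal (T.fst e) e) x
        set b := traction (u (T.snd e)) (normal (T.snd e) e) x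
        have := parallelogram_law_with_norm ℝ a b
        have hn : ‖(1 / 2 : ℝ)‖ = 1 / 2 := by norm_num
        rw [hn]
        nlinarith [sq_nonneg ‖a + b‖, sq_nonneg ‖a‖, sq_nonneg ‖b‖]
      have h5 := mul_le_mul_of_nonneg_left h4 (Metric.diam_nonneg (s := hull e))
      have h6 := mul_le_mul_of_nonneg_left h3 hC
      linarith
    · have h1 := hε _ hfst.1 e he hfst.2
      have h3 := hsum {T.fst e} (by
        intro K hK
        rw [Finset.mem_singleton] at hK
        exact hK ▸ hfst)
      rw [Finset.sum_singleton] at h3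
      have h6 := mul_le_mul_of_nonneg_left h3 hC
      simp only [avgStrain, hi, if_false, faceIntegral]
      linarith
  calc _ ≤ ∑ e ∈ T.faces, C * ∑ K ∈ T.elems with e ⊆ K, g K := Finset.sum_le_sum hface
    _ = C * ∑ e ∈ T.faces, ∑ K ∈ T.elems with e ⊆ K, g K := by rw [Finset.mul_sum]
    _ ≤ C * ((d + 1) * ∑ K ∈ T.elems, g K) :=
        mul_le_mul_of_nonneg_left (T.sum_faces_sum_elems_le fun K _ => hg0 K) hC
    _ = _ := by ring

end Triangulation

/-! ### The weak divergence of piecewise polynomial fields -/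

theorem hasFDerivAt_ev (p : MvPolynomial (Fin d) ℝ) (x : Pt d) :
    HasFDerivAt (ev p) (∑ i, ev (MvPolynomial.pderiv i p) x •
      (EuclideanSpace.proj i : Pt d →L[ℝ] ℝ)) x := by
  classical
  induction p using MvPolynomial.induction_on with
  | C a =>
    have h : ev (MvPolynomial.C a) = fun _ : Pt d => a := by funext y; simp [ev]
    rw [h]
    refine (hasFDerivAt_const a x).congr_fderiv ?_
    simp [ev]
  | add p q hp hq =>
    have h : ev (p + q) = ev p + ev q := by funext y; simp [ev]
    rw [h]
    refine (hp.add hq).congr_fderiv ?_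
    rw [← Finset.sum_add_distrib]
    refine Finset.sum_congr rfl fun i _ => ?_
    simp [ev, add_smul]
  | mul_X p j hp =>
    have h : ev (p * MvPolynomial.X j) = ev p * fun y : Pt d => y j := by funext y; simp [ev]
    rw [h]
    refine (hp.mul (EuclideanSpace.proj j : Pt d →L[ℝ] ℝ).hasFDerivAt).congr_fderiv ?_
    have hi : ∀ i, ev (MvPolynomial.pderiv i (p * MvPolynomial.X j)) x
        = x j * ev (MvPolynomial.pderiv i p) x + if i = j then ev p x else 0 := fun i => by
      rw [Derivation.leibniz, MvPolynomial.pderiv_X]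
      by_cases hij : i = j
      · subst hij; simp [ev, add_comm]
      · simp [ev, hij, Ne.symm hij]
    simp only [hi, add_smul, Finset.sum_add_distrib, ite_smul, zero_smul, Finset.sum_ite_eq',
      Finset.mem_univ, if_true, Finset.smul_sum, smul_smul]
    rw [add_comm]
    rfl

/-- The divergence of a polynomial vector field. -/
def divPoly (u : Fin d → MvPolynomial (Fin d) ℝ) : MvPolynomial (Fin d) ℝ :=
  ∑ i, MvPolynomial.pderiv i (u i)

theorem divPoly_sq_le (u : Fin d → MvPolynomial (Fin d) ℝ) (x : Pt d) :
    ev (divPoly u) x ^ 2 ≤ d * ∑ i, ∑ j, ev (MvPolynomial.pderiv j (u i)) x ^ 2 := by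
  have h : ev (divPoly u) x = ∑ i, ev (MvPolynomial.pderiv i (u i)) x := by
    rw [ev, divPoly, map_sum]; rfl
  rw [h]
  refine (sq_sum_le_card_mul_sum_sq).trans ?_
  rw [Finset.card_univ, Fintype.card_fin]
  refine mul_le_mul_of_nonneg_left (Finset.sum_le_sum fun i _ => ?_) (Nat.cast_nonneg d)
  exact Finset.single_le_sum (f := fun j => ev (MvPolynomial.pderiv j (u i)) x ^ 2)
    (fun j _ => sq_nonneg _) (Finset.mem_univ i)

/-- Integration by parts in each coordinate; the compact support of `φ` makes every product
integrable and removes boundary terms. -/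
theorem integral_fderiv_evV (u : Fin d → MvPolynomial (Fin d) ℝ) {φ : Pt d → ℝ}
    (hφ : ContDiff ℝ ∞ φ) (hc : HasCompactSupport φ) :
    ∫ x, fderiv ℝ φ x (evV u x) = - ∫ x, ev (divPoly u) x * φ x := by
  have hd : ∀ i, Continuous fun x => fderiv ℝ φ x (EuclideanSpace.single i 1) := fun i =>
    (hφ.continuous_fderiv (by simp)).clm_apply continuous_const
  have hφc := hφ.continuous
  have hc' : ∀ i, HasCompactSupport fun x => fderiv ℝ φ x (EuclideanSpace.single i 1) := fun i =>
    hc.fderiv_apply ℝ _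
  have h1 : ∀ i, Integrable (fun x => ev (u i) x * fderiv ℝ φ x (EuclideanSpace.single i 1)) :=
    fun i => ((continuous_ev _).mul (hd i)).integrable_of_hasCompactSupport (hc' i).mul_left
  have h2 : ∀ p : MvPolynomial (Fin d) ℝ, Integrable (fun x => ev p x * φ x) :=
    fun p => ((continuous_ev _).mul hφc).integrable_of_hasCompactSupport hc.mul_left
  have hf : ∀ i x, fderiv ℝ (ev (u i)) x (EuclideanSpace.single i 1)
      = ev (MvPolynomial.pderiv i (u i)) x := fun i x => by
    rw [(hasFDerivAt_ev _ _).fderiv]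
    simp
  have hv : ∀ x, fderiv ℝ φ x (evV u x)
      = ∑ i, ev (u i) x * fderiv ℝ φ x (EuclideanSpace.single i 1) := fun x => by
    have : evV u x = ∑ i, ev (u i) x • EuclideanSpace.single i (1 : ℝ) := by
      ext j
      simp [evV, Pi.single_apply]
    rw [this, map_sum]
    simp
  have hp : ∀ x, ev (divPoly u) x * φ x = ∑ i, ev (MvPolynomial.pderiv i (u i)) x * φ x :=
    fun x => by rw [← Finset.sum_mul]; congr 1; rw [ev, divPoly, map_sum]; rfl
  simp only [hv, hp]
  rw [integral_finsetSum _ fun i _ => h1 i, integral_finsetSum _ fun i _ => h2 _,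
    ← Finset.sum_neg_distrib]
  refine Finset.sum_congr rfl fun i _ => ?_
  rw [integral_mul_fderiv_eq_neg_fderiv_mul_of_integrable]
  · simp only [hf]
  · simpa only [hf] using h2 _
  · exact h1 i
  · exact h2 _
  · exact fun x _ => (hasFDerivAt_ev _ _).differentiableAt
  · exact fun x _ => hφ.differentiable (by simp) x

/-! ### Piecewise polynomials on the domain and their weak divergence -/

namespace Triangulation
variable {Ω : Set (Pt d)} (T : Triangulation d Ω)

theorem isOpen_domain {Ω : Set (Pt d)} (T : Triangulation d Ω) : IsOpen Ω := by
  rw [← T.cover]; exact isOpen_interior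

theorem domain_subset : Ω ⊆ ⋃ K ∈ T.elems, hull K := by
  conv_lhs => rw [← T.cover]
  exact interior_subset

theorem isBounded_domain {Ω : Set (Pt d)} (T : Triangulation d Ω) : Bornology.IsBounded Ω :=
  ((T.elems.finite_toSet.isCompact_biUnion fun K _ => isCompact_hull K).isBounded).subset
    T.domain_subset

theorem measure_domain_lt_top {Ω : Set (Pt d)} (T : Triangulation d Ω) : volume Ω < ⊤ := T.isBounded_domain.measure_lt_top

theorem interior_hull_subset {K : Finset (Pt d)} (hK : K ∈ T.elems) : interior (hull K) ⊆ Ω := by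
  conv_rhs => rw [← T.cover]
  exact interior_mono (Set.subset_biUnion_of_mem (u := fun K => hull K) hK)

/-- If the interiors met, the hull of the common vertices would have nonempty interior, so these
vertices would affinely span the space. They omit a vertex of `K`, which contradicts affine
independence. -/
theorem disjoint_interior {K L : Finset (Pt d)} (hK : K ∈ T.elems) (hL : L ∈ T.elems)
    (hKL : K ≠ L) : Disjoint (interior (hull K)) (interior (hull L)) := by
  rw [Set.disjoint_iff_inter_eq_empty, ← Set.not_nonempty_iff_eq_empty, ← interior_inter]
  intro hne
  have h1 : (interior (convexHull ℝ ((K : Set (Pt d)) ∩ (L : Set (Pt d))))).Nonempty :=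
    hne.mono (interior_mono (T.inter K hK L hL))
  rw [interior_convexHull_nonempty_iff_affineSpan_eq_top] at h1
  obtain ⟨p, hpK, hpL⟩ : ∃ p ∈ K, p ∉ L := by
    by_contra! h
    exact hKL (Finset.eq_of_subset_of_card_le h (by rw [T.card_elem K hK, T.card_elem L hL]))
  refine (T.indep K hK).notMem_affineSpan_sdiff ⟨p, hpK⟩ Set.univ ?_
  have hsub : (K : Set (Pt d)) ∩ L ⊆
      ((↑) : K → Pt d) '' (Set.univ \ {⟨p, hpK⟩}) := by
    rintro x ⟨hxK, hxL⟩
    refine ⟨⟨x, hxK⟩, ⟨trivial, fun h => hpL ?_⟩, rfl⟩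
    rw [Set.mem_singleton_iff, Subtype.mk.injEq] at h
    exact h ▸ hxL
  refine affineSpan_mono ℝ hsub ?_
  rw [h1]
  exact AffineSubspace.mem_top ℝ _ _

theorem sum_indicator_eq {E : Type*} [AddCommMonoid E] (f : Finset (Pt d) → Pt d → E)
    {K : Finset (Pt d)} (hK : K ∈ T.elems) {x : Pt d} (hx : x ∈ interior (hull K)) :
    ∑ L ∈ T.elems, (interior (hull L)).indicator (f L) x = f K x := by
  rw [Finset.sum_eq_single K, Set.indicator_of_mem hx]
  · intro L hL hLK
    exact Set.indicator_of_notMem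
      (fun h => Set.disjoint_left.1 (T.disjoint_interior hL hK hLK) h hx) _
  · exact fun h => absurd hK h

theorem glue_eq (q : ScalarField d) {K : Finset (Pt d)} (hK : K ∈ T.elems) {x : Pt d}
    (hx : x ∈ interior (hull K)) : T.glue q x = ev (q K) x :=
  T.sum_indicator_eq (fun K => ev (q K)) hK hx

theorem glueV_eq (u : VectorField d) {K : Finset (Pt d)} (hK : K ∈ T.elems) {x : Pt d}
    (hx : x ∈ interior (hull K)) : T.glueV u x = evV (u K) x :=
  T.sum_indicator_eq (fun K => evV (u K)) hK hx

/-- The simplices cover the domain, and the frontier of a convex set is null. -/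
theorem ae_mem_interior_hull :
    ∀ᵐ x ∂(volume.restrict Ω), ∃ K ∈ T.elems, x ∈ interior (hull K) := by
  have h : ∀ᵐ x : Pt d, ∀ K ∈ T.elems, x ∉ frontier (hull K) := by
    rw [Filter.eventually_all_finset]
    exact fun K _ => measure_eq_zero_iff_ae_notMem.1 ((convex_convexHull ℝ _).addHaar_frontier _)
  filter_upwards [ae_restrict_of_ae h, ae_restrict_mem T.isOpen_domain.measurableSet] with x hx hΩ
  obtain ⟨K, hK, hxK⟩ := Set.mem_iUnion₂.1 (T.domain_subset hΩ)
  refine ⟨K, hK, ?_⟩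
  by_contra hn
  exact hx K hK ⟨subset_closure hxK, hn⟩

theorem memLp_glue (q : ScalarField d) : MemLp (T.glue q) 2 (volume.restrict Ω) := by
  unfold glue
  exact memLp_finsetSum _ fun K _ => (memLp_restrict_of_continuous T.isBounded_domain
    T.isOpen_domain.measurableSet T.measure_domain_lt_top (continuous_ev _) 2).indicator
      isOpen_interior.measurableSet

variable {T} in
theorem div_spec {u : VectorField d} (hu : MemHDiv Ω (T.glueV u)) :
    MemLp (T.div u) 2 (volume.restrict Ω) ∧ IsWeakDiv Ω (T.glueV u) (T.div u) := by
  rw [div, weakDiv, dif_pos hu]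
  exact hu.2.choose_spec

/-- The weak divergence of a piecewise polynomial field is its piecewise divergence. -/
theorem div_ae_eq {u : VectorField d} (hu : MemHDiv Ω (T.glueV u)) :
    T.div u =ᵐ[volume.restrict Ω] T.glue fun K => divPoly (u K) := by
  have : IsFiniteMeasure (volume.restrict Ω) := ⟨by simpa using T.measure_domain_lt_top⟩
  obtain ⟨hL, hw⟩ := div_spec hu
  have hK : ∀ K ∈ T.elems, ∀ᵐ x ∂(volume.restrict Ω), x ∈ interior (hull K) →
      T.div u x - ev (divPoly (u K)) x = 0 := by
    intro K hK
    have hp : MemLp (ev (divPoly (u K))) 2 (volume.restrict Ω) :=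
      memLp_restrict_of_continuous T.isBounded_domain
        T.isOpen_domain.measurableSet T.measure_domain_lt_top (continuous_ev _) 2
    have hi : Integrable (fun x => T.div u x - ev (divPoly (u K)) x) (volume.restrict Ω) :=
      (hL.sub hp).integrable (by norm_num)
    -- Test functions supported inside one element see only the polynomial on it, so classical
    -- integration by parts identifies the divergence there.
    refine isOpen_interior.ae_eq_zero_of_integral_contDiff_smul_eq_zero
      (hi.locallyIntegrable.locallyIntegrableOn _) fun φ hφ hc hs => ?_
    have hsΩ : tsupport φ ⊆ Ω := hs.trans (T.interior_hull_subset hK)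
    have h1 := hw φ hφ hc hsΩ
    have hφΩ : ∀ f : Pt d → ℝ, ∫ x in Ω, f x * φ x = ∫ x, f x * φ x := fun f =>
      setIntegral_eq_integral_of_forall_compl_eq_zero fun x hx => by
        rw [image_eq_zero_of_notMem_tsupport fun h => hx (hsΩ h), mul_zero]
    have h2 : ∫ x in Ω, fderiv ℝ φ x (T.glueV u x) = ∫ x, fderiv ℝ φ x (evV (u K) x) := by
      rw [setIntegral_eq_integral_of_forall_compl_eq_zero]
      · refine integral_congr_ae (Filter.Eventually.of_forall fun x => ?_)
        by_cases hx : x ∈ tsupport φ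
        · simp only [T.glueV_eq u hK (hs hx)]
        · have : fderiv ℝ φ x = 0 := by
            by_contra h
            exact hx (support_fderiv_subset ℝ h)
          simp [this]
      · intro x hx
        have : fderiv ℝ φ x = 0 := by
          by_contra h
          exact hx (hsΩ (support_fderiv_subset ℝ h))
        simp [this]
    rw [h2, integral_fderiv_evV (u K) hφ hc, neg_inj, ← hφΩ] at h1
    obtain ⟨B, hB⟩ := hc.exists_bound_of_continuous hφ.continuous
    have hm : ∀ f : Pt d → ℝ, MemLp f 2 (volume.restrict Ω) →
        Integrable (fun x => f x * φ x) (volume.restrict Ω) := fun f hf =>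
      (hf.integrable (by norm_num)).mul_bdd hφ.continuous.aestronglyMeasurable
        (Filter.Eventually.of_forall hB)
    have h3 : ∀ x, φ x • (T.div u x - ev (divPoly (u K)) x)
        = T.div u x * φ x - ev (divPoly (u K)) x * φ x := fun x => by
      rw [smul_eq_mul]; ring
    simp only [h3]
    rw [integral_sub (hm _ hL) (hm _ hp), h1, sub_self]
  have hall := (Filter.eventually_all_finset T.elems).2 hK
  filter_upwards [hall, T.ae_mem_interior_hull] with x h1 ⟨K, hKT, hx⟩
  rw [T.glue_eq _ hKT hx]
  exact sub_eq_zero.1 (h1 K hKT hx)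

/-- The pointwise bound by the trace of the gradient transfers to the weak divergence because the
two agree almost everywhere. It controls the divergence when `λ` is small. -/
theorem integral_div_sq_le {u : VectorField d} (hu : MemHDiv Ω (T.glueV u)) :
    ∫ x in Ω, T.div u x ^ 2 ≤ d * ∑ K ∈ T.elems,
      ∫ x in hull K, ∑ i, ∑ j, ev (MvPolynomial.pderiv j (u K i)) x ^ 2 := by
  set G : Finset (Pt d) → Pt d → ℝ := fun K x =>
    d * ∑ i, ∑ j, ev (MvPolynomial.pderiv j (u K i)) x ^ 2 with hG
  have hG0 : ∀ K x, 0 ≤ G K x := fun K x => by positivity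
  have hGc : ∀ K, Continuous (G K) := fun K => by fun_prop
  have hint : ∀ K, Integrable ((hull K).indicator (G K)) := fun K =>
    (integrable_indicator_iff (measurableSet_hull K)).2 (integrable_hull (hGc K))
  have hsum := integrable_finsetSum T.elems fun K _ => hint K
  calc ∫ x in Ω, T.div u x ^ 2
      ≤ ∫ x in Ω, ∑ K ∈ T.elems, (hull K).indicator (G K) x := by
        refine integral_mono_ae (div_spec hu).1.integrable_sq hsum.integrableOn ?_
        filter_upwards [T.div_ae_eq hu, T.ae_mem_interior_hull] with x h1 ⟨K, hK, hx⟩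
        rw [h1, T.glue_eq _ hK hx]
        refine (divPoly_sq_le _ _).trans ?_
        refine le_trans ?_ (Finset.single_le_sum
          (f := fun K => (hull K).indicator (G K) x)
          (fun L _ => Set.indicator_nonneg (fun x _ => hG0 L x) x) hK)
        rw [Set.indicator_of_mem (interior_subset hx)]
    _ ≤ ∫ x, ∑ K ∈ T.elems, (hull K).indicator (G K) x :=
        setIntegral_le_integral hsum (Filter.Eventually.of_forall fun x =>
          Finset.sum_nonneg fun L _ => Set.indicator_nonneg (fun x _ => hG0 L x) x)
    _ = _ := by
        rw [integral_finsetSum _ fun K _ => hint K, Finset.mul_sum]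
        refine Finset.sum_congr rfl fun K _ => ?_
        rw [integral_indicator (measurableSet_hull K), hG, integral_const_mul]

end Triangulation

namespace Triangulation

/-! ### Boundedness of `a_h` -/

section
variable {Ω : Set (Pt d)} (T : Triangulation d Ω)

/-- The squared broken `H¹` seminorm. -/
def gradSq (u : VectorField d) : ℝ :=
  ∑ K ∈ T.elems, ∫ x in hull K, ∑ i, ∑ j, ev (MvPolynomial.pderiv j (u K i)) x ^ 2

/-- The squared norm of the tangential jumps. -/
def jumpSq (u : VectorField d) : ℝ :=
  ∑ e ∈ T.faces, (Metric.diam (hull e))⁻¹ * faceIntegral e fun x => ‖T.jumpTang u e x‖ ^ 2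

theorem gradSq_nonneg (u : VectorField d) : 0 ≤ T.gradSq u :=
  Finset.sum_nonneg fun K _ => integral_nonneg fun x => by positivity

theorem jumpSq_nonneg (u : VectorField d) : 0 ≤ T.jumpSq u :=
  Finset.sum_nonneg fun e _ => mul_nonneg (inv_nonneg.2 Metric.diam_nonneg)
    (integral_nonneg fun x => by positivity)

theorem gradSq_add_jumpSq_le (u : VectorField d) : T.gradSq u + T.jumpSq u ≤ T.dgNormSq u := by
  refine le_add_of_nonneg_right (Finset.sum_nonneg fun K _ => ?_)
  exact mul_nonneg (sq_nonneg _) (integral_nonneg fun x => by positivity)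

theorem abs_strain_term_le (u w : VectorField d) :
    |∑ K ∈ T.elems, ∫ x in hull K, ∑ i, ∑ j, ev (strain (u K) i j) x * ev (strain (w K) i j) x|
      ≤ √(T.gradSq u) * √(T.gradSq w) := by
  refine abs_sum_le_sqrt_mul_sqrt _ (fun K _ => integral_nonneg fun x => by positivity)
    (fun K _ => integral_nonneg fun x => by positivity) fun K _ => ?_
  refine abs_integral_le_sqrt_mul_sqrt (integrable_hull (by fun_prop))
    (integrable_hull (by fun_prop)) (fun x => by positivity) (fun x => by positivity) fun x => ?_
  refine le_trans ?_ (mul_le_mul (sum_strain_sq_le (u K) x) (sum_strain_sq_le (w K) x)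
    (by positivity) (by positivity))
  simp only [← Fintype.sum_prod_type']
  exact Finset.sum_mul_sq_le_sq_mul_sq _ _ _

theorem abs_average_jump_term_le (hd : 2 ≤ d) (u w : VectorField d) :
    |∑ e ∈ T.faces, faceIntegral e fun x => inner ℝ (T.avgStrain u e x) (T.jumpTang w e x)|
      ≤ √(∑ e ∈ T.faces, Metric.diam (hull e) *
          faceIntegral e (fun x => ‖T.avgStrain u e x‖ ^ 2)) * √(T.jumpSq w) := by
  refine abs_sum_le_sqrt_mul_sqrt _
    (fun e _ => mul_nonneg Metric.diam_nonneg (integral_nonneg fun x => by positivity))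
    (fun e _ => mul_nonneg (inv_nonneg.2 Metric.diam_nonneg)
      (integral_nonneg fun x => by positivity)) fun e he => ?_
  -- For `d ≥ 2` a face has two distinct vertices, so the weights `h_e` and `h_e⁻¹` cancel; the
  -- faces of dimension zero in the case `d = 1` would have diameter zero.
  have hpos := diam_hull_pos (hd.trans_eq (T.card_face he).symm)
  simp only [faceIntegral, ← integral_const_mul]
  have hint : ∀ {f : Pt d → ℝ}, Continuous f → Integrable f (μHE[d - 1].restrict (hull e)) :=
    fun hf => integrable_face (by omega) (T.card_face he) (T.affineIndependent_face he) hf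
  refine abs_integral_le_sqrt_mul_sqrt (hint (by fun_prop)) (hint (by fun_prop))
    (fun x => by positivity) (fun x => by positivity) fun x => ?_
  have h := abs_real_inner_le_norm (T.avgStrain u e x) (T.jumpTang w e x)
  calc inner ℝ (T.avgStrain u e x) (T.jumpTang w e x) ^ 2
      ≤ (‖T.avgStrain u e x‖ * ‖T.jumpTang w e x‖) ^ 2 := sq_le_sq' (abs_le.1 h).1 (abs_le.1 h).2
    _ = _ := by field_simp

theorem abs_penalty_term_le (hd : 2 ≤ d) {η : ℝ} (hη : 0 ≤ η) (u w : VectorField d) :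
    |∑ e ∈ T.faces, faceIntegral e fun x =>
      η * (Metric.diam (hull e))⁻¹ * inner ℝ (T.jumpTang u e x) (T.jumpTang w e x)|
      ≤ η * (√(T.jumpSq u) * √(T.jumpSq w)) := by
  simp only [faceIntegral, mul_assoc, integral_const_mul]
  rw [← Finset.mul_sum, abs_mul, abs_of_nonneg hη]
  refine mul_le_mul_of_nonneg_left ?_ hη
  refine abs_sum_le_sqrt_mul_sqrt _
    (fun e _ => mul_nonneg (inv_nonneg.2 Metric.diam_nonneg)
      (integral_nonneg fun x => by positivity))
    (fun e _ => mul_nonneg (inv_nonneg.2 Metric.diam_nonneg)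
      (integral_nonneg fun x => by positivity)) fun e he => ?_
  simp only [faceIntegral, ← integral_const_mul]
  have hint : ∀ {f : Pt d → ℝ}, Continuous f → Integrable f (μHE[d - 1].restrict (hull e)) :=
    fun hf => integrable_face (by omega) (T.card_face he) (T.affineIndependent_face he) hf
  have hh : 0 ≤ (Metric.diam (hull e))⁻¹ := inv_nonneg.2 Metric.diam_nonneg
  refine abs_integral_le_sqrt_mul_sqrt (hint (by fun_prop)) (hint (by fun_prop))
    (fun x => by positivity) (fun x => by positivity) fun x => ?_
  have h := abs_real_inner_le_norm (T.jumpTang u e x) (T.jumpTang w e x)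
  calc ((Metric.diam (hull e))⁻¹ * inner ℝ (T.jumpTang u e x) (T.jumpTang w e x)) ^ 2
      = (Metric.diam (hull e))⁻¹ ^ 2 * inner ℝ (T.jumpTang u e x) (T.jumpTang w e x) ^ 2 := by ring
    _ ≤ (Metric.diam (hull e))⁻¹ ^ 2 * (‖T.jumpTang u e x‖ * ‖T.jumpTang w e x‖) ^ 2 :=
        mul_le_mul_of_nonneg_left (sq_le_sq' (abs_le.1 h).1 (abs_le.1 h).2) (sq_nonneg _)
    _ = _ := by ring

end

theorem exists_abs_ah_le {d : ℕ} (hd : 2 ≤ d) (l : ℕ) (σ : ℝ) {η : ℝ} (hη : 0 ≤ η) :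
    ∃ C : ℝ, 0 ≤ C ∧ ∀ (Ω : Set (Pt d)) (T : Triangulation d Ω), T.ShapeRegular σ →
      ∀ u w : VectorField d, (∀ K ∈ T.elems, ∀ i, (u K i).totalDegree ≤ l) →
        (∀ K ∈ T.elems, ∀ i, (w K i).totalDegree ≤ l) →
        |T.ah η u w| ≤ C * (√(T.dgNormSq u) * √(T.dgNormSq w)) := by
  obtain ⟨C, hC, h⟩ := exists_avgStrain_le (d := d) (by omega) l σ
  -- The strain term contributes `1`, each of the two average-jump terms `√C`, the penalty `η`.
  refine ⟨1 + 2 * √C + η, by positivity, fun Ω T hT u w hu hw => ?_⟩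
  have hG : ∀ v, √(T.gradSq v) ≤ √(T.dgNormSq v) := fun v => Real.sqrt_le_sqrt
    (by linarith [T.gradSq_add_jumpSq_le v, T.jumpSq_nonneg v])
  have hJ : ∀ v, √(T.jumpSq v) ≤ √(T.dgNormSq v) := fun v => Real.sqrt_le_sqrt
    (by linarith [T.gradSq_add_jumpSq_le v, T.gradSq_nonneg v])
  have hA : ∀ v, (∀ K ∈ T.elems, ∀ i, (v K i).totalDegree ≤ l) →
      √(∑ e ∈ T.faces, Metric.diam (hull e) * faceIntegral e (fun x => ‖T.avgStrain v e x‖ ^ 2))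
        ≤ √C * √(T.dgNormSq v) := fun v hv => by
    refine (Real.sqrt_le_sqrt (h Ω T hT v hv)).trans ?_
    rw [Real.sqrt_mul hC]
    exact mul_le_mul_of_nonneg_left (hG v) (Real.sqrt_nonneg _)
  have h1 := (T.abs_strain_term_le u w).trans
    (mul_le_mul (hG u) (hG w) (Real.sqrt_nonneg _) (Real.sqrt_nonneg _))
  have h2 := (T.abs_average_jump_term_le hd u w).trans
    (mul_le_mul (hA u hu) (hJ w) (Real.sqrt_nonneg _) (by positivity))
  have h3 := (T.abs_average_jump_term_le hd w u).trans
    (mul_le_mul (hA w hw) (hJ u) (Real.sqrt_nonneg _) (by positivity))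
  have h4 := (T.abs_penalty_term_le hd hη u w).trans (mul_le_mul_of_nonneg_left
    (mul_le_mul (hJ u) (hJ w) (Real.sqrt_nonneg _) (Real.sqrt_nonneg _)) hη)
  have e1 := abs_le.1 h1
  have e2 := abs_le.1 h2
  have e3 := abs_le.1 h3
  have e4 := abs_le.1 h4
  rw [ah, abs_le]
  constructor <;> linarith

end Triangulation

/-! ### The matrix `Λ` -/

theorem posSemidef_of_forall {n : ℕ} {B : Matrix (Fin n) (Fin n) ℝ} (hs : ∀ i j, B i j = B j i)
    (h : ∀ x : Fin n → ℝ, 0 ≤ ∑ i, ∑ j, B i j * x i * x j) : B.PosSemidef := by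
  refine Matrix.PosSemidef.of_dotProduct_mulVec_nonneg (Matrix.ext fun i j => ?_) fun x => ?_
  · simp [hs i j]
  · refine (h x).trans_eq ?_
    simp only [dotProduct, mulVec, star_trivial, Finset.mul_sum]
    exact Finset.sum_congr rfl fun i _ => Finset.sum_congr rfl fun j _ => by ring

theorem mulVec_dotProduct_nonneg {n : ℕ} {B : Matrix (Fin n) (Fin n) ℝ} (hB : B.PosSemidef)
    (x : Fin n → ℝ) : 0 ≤ B *ᵥ x ⬝ᵥ x := by
  rw [dotProduct_comm]
  simpa using hB.dotProduct_mulVec_nonneg x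

namespace Params
variable {n : ℕ} (M : Params n)

theorem lam0_pos : 0 < M.lam0 := one_pos.trans_le (le_max_left _ _)

theorem lam0_le : M.lam0 ≤ 1 + M.lam :=
  max_le (by linarith [M.lam_pos]) (by linarith)

theorem Rinv_pos (i : Fin n) : 0 < M.Rinv i := by
  have := M.tau_pos; have := M.K_pos i; have := M.alpha_pos i
  unfold Rinv; positivity

theorem RinvMax_pos [NeZero n] : 0 < M.RinvMax :=
  (M.Rinv_pos 0).trans_le (Finset.le_sup' M.Rinv (Finset.mem_univ 0))

theorem alphaNet_symm (i j : Fin n) : M.alphaNet i j = M.alphaNet j i := by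
  by_cases h : i = j
  · rw [h]
  · rw [alphaNet, alphaNet, betaFull, betaFull, if_neg h, if_neg (Ne.symm h), M.beta_symm,
      mul_comm (M.alpha i)]

/-- With `y_i = x_i / α_i` the quadratic form becomes that of a weighted graph Laplacian, `½ ∑ τ
β_ij (y_i - y_j)²` over `i ≠ j`. -/
theorem posSemidef_Lambda1 : M.Lambda1.PosSemidef := by
  refine posSemidef_of_forall (fun i j => ?_) fun x => ?_
  · by_cases h : i = j
    · rw [h]
    · simp [Lambda1, h, Ne.symm h, M.alphaNet_symm i j]
  -- The diagonal weights are set to zero, so that full row sums of `b` give the diagonal of `Λ₁`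
  -- after rescaling.
  set b : Fin n → Fin n → ℝ := fun i j => if i = j then 0 else M.tau * M.beta i j with hb
  set y : Fin n → ℝ := fun i => x i / M.alpha i with hy
  have hb0 : ∀ i j, 0 ≤ b i j := fun i j => by
    simp only [hb]
    split_ifs
    · exact le_rfl
    · exact mul_nonneg M.tau_pos.le (M.beta_nonneg i j)
  have hbs : ∀ i j, b i j = b j i := fun i j => by
    by_cases h : i = j
    · rw [h]
    · simp [hb, h, Ne.symm h, M.beta_symm i j]
  have hdiag : ∀ i, M.tau * ∑ k ∈ Finset.univ.erase i, M.beta i k = ∑ k, b i k := fun i => by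
    rw [← Finset.add_sum_erase _ _ (Finset.mem_univ i), Finset.mul_sum]
    simp only [hb, if_true, zero_add]
    refine Finset.sum_congr rfl fun k hk => ?_
    rw [if_neg (Finset.ne_of_mem_erase hk).symm]
  have hterm : ∀ i j, M.Lambda1 i j * x i * x j
      = (if i = j then (∑ k, b i k) * y i ^ 2 else 0) - b i j * (y i * y j) := fun i j => by
    have hi := (M.alpha_pos i).ne'
    have hj := (M.alpha_pos j).ne'
    by_cases h : i = j
    · subst h
      simp only [Lambda1, Matrix.of_apply, if_true, alphaNet, betaFull, hdiag, hb, hy]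
      field_simp
      simp [mul_comm]
    · simp only [Lambda1, Matrix.of_apply, h, if_false, alphaNet, betaFull, hb, hy]
      field_simp
      simp
  have hrow : ∀ i, ∑ j, M.Lambda1 i j * x i * x j = ∑ j, b i j * (y i ^ 2 - y i * y j) :=
    fun i => by
      simp only [hterm, Finset.sum_sub_distrib, Finset.sum_ite_eq, Finset.mem_univ, if_true,
        mul_sub, Finset.sum_mul]
  have hswap : ∑ i, ∑ j, b i j * (y i ^ 2 - y i * y j)
      = ∑ i, ∑ j, b i j * (y j ^ 2 - y i * y j) := by
    rw [Finset.sum_comm]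
    refine Finset.sum_congr rfl fun i _ => Finset.sum_congr rfl fun j _ => ?_
    rw [hbs j i]; ring
  have hdouble : 2 * ∑ i, ∑ j, b i j * (y i ^ 2 - y i * y j)
      = ∑ i, ∑ j, b i j * (y i - y j) ^ 2 := by
    rw [two_mul]
    conv_lhs => enter [2]; rw [hswap]
    simp only [← Finset.sum_add_distrib]
    exact Finset.sum_congr rfl fun i _ => Finset.sum_congr rfl fun j _ => by ring
  have hnn : 0 ≤ ∑ i, ∑ j, b i j * (y i - y j) ^ 2 :=
    Finset.sum_nonneg fun i _ => Finset.sum_nonneg fun j _ => mul_nonneg (hb0 i j) (sq_nonneg _)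
  simp only [hrow]
  linarith

theorem posSemidef_Lambda2 : M.Lambda2.PosSemidef :=
  Matrix.PosSemidef.diagonal fun i => div_nonneg (M.c_nonneg i) (sq_nonneg _)

theorem posDef_Lambda3 [NeZero n] : M.Lambda3.PosDef :=
  Matrix.PosDef.diagonal fun _ => inv_pos.2 M.RinvMax_pos

theorem Lambda4_mulVec_dotProduct (x y : Fin n → ℝ) :
    M.Lambda4 *ᵥ x ⬝ᵥ y = 1 / M.lam0 * ((∑ i, x i) * ∑ i, y i) := by
  simp only [Lambda4, mulVec, dotProduct, Matrix.of_apply, ← Finset.mul_sum]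
  ring

theorem posSemidef_Lambda4 : M.Lambda4.PosSemidef := by
  refine posSemidef_of_forall (fun i j => rfl) fun x => ?_
  have : ∑ i, ∑ j, M.Lambda4 i j * x i * x j = 1 / M.lam0 * ((∑ i, x i) * ∑ i, x i) := by
    rw [← Lambda4_mulVec_dotProduct]
    simp only [mulVec, dotProduct, Finset.sum_mul, Lambda4, Matrix.of_apply]
    exact Finset.sum_congr rfl fun i _ => Finset.sum_congr rfl fun j _ => by ring
  rw [this]
  exact mul_nonneg (one_div_nonneg.2 M.lam0_pos.le) (mul_self_nonneg _)

/-- Strict positivity comes from `Λ₃` alone; the other three summands are semidefinite. -/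
theorem posDef_Lambda [NeZero n] : M.Lambda.PosDef := by
  have h := (M.posDef_Lambda3.posSemidef_add (M.posSemidef_Lambda1.add M.posSemidef_Lambda2))
  exact h.add_posSemidef M.posSemidef_Lambda4

theorem Lambda12_le [NeZero n] (x : Fin n → ℝ) :
    (M.Lambda1 + M.Lambda2) *ᵥ x ⬝ᵥ x ≤ M.Lambda *ᵥ x ⬝ᵥ x := by
  rw [Lambda, add_mulVec _ M.Lambda4, add_mulVec _ M.Lambda3, add_dotProduct, add_dotProduct]
  linarith [mulVec_dotProduct_nonneg M.posDef_Lambda3.posSemidef x,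
    mulVec_dotProduct_nonneg M.posSemidef_Lambda4 x]

/-- The form of `Λ₄` is exactly `(∑ x_i)² / λ₀`, and the other summands only add to it. Hence no
factor `n` appears. -/
theorem sum_sq_le_Lambda [NeZero n] (x : Fin n → ℝ) :
    (∑ i, x i) ^ 2 ≤ M.lam0 * (M.Lambda *ᵥ x ⬝ᵥ x) := by
  have h : (1 / M.lam0) * ((∑ i, x i) * ∑ i, x i) ≤ M.Lambda *ᵥ x ⬝ᵥ x := by
    rw [← Lambda4_mulVec_dotProduct, Lambda, add_mulVec _ M.Lambda4, add_mulVec _ M.Lambda3,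
      add_dotProduct, add_dotProduct]
    linarith [mulVec_dotProduct_nonneg M.posDef_Lambda3.posSemidef x,
      mulVec_dotProduct_nonneg (M.posSemidef_Lambda1.add M.posSemidef_Lambda2) x]
  rw [one_div, inv_mul_le_iff₀ M.lam0_pos] at h
  rwa [sq]

end Params

/-! ### Boundedness of the remaining terms in the weighted norms -/

theorem integrable_mulVec_dotProduct {α : Type*} [MeasurableSpace α] {μ : Measure α} {n : ℕ}
    (B : Matrix (Fin n) (Fin n) ℝ) {f g : Fin n → α → ℝ} (hf : ∀ i, MemLp (f i) 2 μ)
    (hg : ∀ i, MemLp (g i) 2 μ) :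
    Integrable (fun x => (B *ᵥ fun i => f i x) ⬝ᵥ fun i => g i x) μ := by
  simp only [mulVec, dotProduct, Finset.sum_mul, mul_assoc]
  exact integrable_finsetSum _ fun i _ => integrable_finsetSum _ fun j _ =>
    ((hf j).integrable_mul (hg i)).const_mul (B i j)

namespace Triangulation
variable {Ω : Set (Pt d)} (T : Triangulation d Ω) {n : ℕ} (M : Params n)

theorem dgNormSq_nonneg (u : VectorField d) : 0 ≤ T.dgNormSq u :=
  (add_nonneg (T.gradSq_nonneg u) (T.jumpSq_nonneg u)).trans (T.gradSq_add_jumpSq_le u)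

theorem integral_div_sq_nonneg (u : VectorField d) : 0 ≤ ∫ x in Ω, T.div u x ^ 2 :=
  integral_nonneg fun _ => sq_nonneg _

theorem sqrt_dgNormSq_le_normU (u : VectorField d) : √(T.dgNormSq u) ≤ T.normU M u :=
  Real.sqrt_le_sqrt (le_add_of_nonneg_right (mul_nonneg M.lam_pos.le (T.integral_div_sq_nonneg u)))

theorem sqrt_lam_div_le_normU (u : VectorField d) :
    √(∫ x in Ω, M.lam * T.div u x ^ 2) ≤ T.normU M u := by
  rw [integral_const_mul]
  exact Real.sqrt_le_sqrt (le_add_of_nonneg_left (T.dgNormSq_nonneg u))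

/-- From `λ₀ ≤ 1 + λ`: the summand `1` is paid by the broken gradient with factor `d`, the summand
`λ` by the divergence part of the norm. -/
theorem sqrt_lam0_div_le_normU {u : VectorField d} (hu : MemHDiv Ω (T.glueV u)) :
    √(∫ x in Ω, M.lam0 * T.div u x ^ 2) ≤ √(d + 1) * T.normU M u := by
  rw [integral_const_mul, normU, ← Real.sqrt_mul (by positivity)]
  refine Real.sqrt_le_sqrt ?_
  have h0 := T.integral_div_sq_nonneg u
  have h1 : ∫ x in Ω, T.div u x ^ 2 ≤ d * T.gradSq u := T.integral_div_sq_le hu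
  have h2 := mul_le_mul_of_nonneg_right M.lam0_le h0
  have h3 := T.gradSq_add_jumpSq_le u
  have h4 := T.jumpSq_nonneg u
  have h5 : (d : ℝ) * T.gradSq u ≤ d * T.dgNormSq u :=
    mul_le_mul_of_nonneg_left (by linarith) (Nat.cast_nonneg d)
  have h6 : 0 ≤ (d : ℝ) * (M.lam * ∫ x in Ω, T.div u x ^ 2) :=
    mul_nonneg (Nat.cast_nonneg d) (mul_nonneg M.lam_pos.le h0)
  linarith [T.dgNormSq_nonneg u]

theorem abs_lam_div_div_le {u w : VectorField d} (hu : MemHDiv Ω (T.glueV u))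
    (hw : MemHDiv Ω (T.glueV w)) :
    |M.lam * ∫ x in Ω, T.div u x * T.div w x| ≤ T.normU M u * T.normU M w := by
  rw [← integral_const_mul]
  refine (abs_integral_le_sqrt_mul_sqrt ((div_spec hu).1.integrable_sq.const_mul _)
    ((div_spec hw).1.integrable_sq.const_mul _)
    (fun x => mul_nonneg M.lam_pos.le (sq_nonneg _))
    (fun x => mul_nonneg M.lam_pos.le (sq_nonneg _)) fun x => le_of_eq (by ring)).trans ?_
  exact mul_le_mul (T.sqrt_lam_div_le_normU M u) (T.sqrt_lam_div_le_normU M w)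
    (Real.sqrt_nonneg _) (Real.sqrt_nonneg _)

theorem integrable_glue_mul (q : ScalarField d) {f : Pt d → ℝ}
    (hf : MemLp f 2 (volume.restrict Ω)) :
    Integrable (fun x => T.glue q x * f x) (volume.restrict Ω) :=
  (T.memLp_glue q).integrable_mul hf

theorem sum_flux_nonneg (v : Fin n → VectorField d) :
    0 ≤ ∑ i, ∫ x in Ω, M.Rinv i * inner ℝ (T.glueV (v i) x) (T.glueV (v i) x) :=
  Finset.sum_nonneg fun i _ => integral_nonneg fun _ =>
    mul_nonneg (M.Rinv_pos i).le real_inner_self_nonneg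

/-- The signs in `Ah` are opposite to those of `Λ₁ + Λ₂` both on and off the diagonal, so the two
sums form a single matrix form. -/
theorem pressure_term_eq (p q : Fin n → ScalarField d) :
    (∑ i, (-M.alphaP i - M.alphaNet i i) * ∫ x in Ω, T.glue (p i) x * T.glue (q i) x)
      + ∑ i, ∑ j ∈ Finset.univ.erase i,
        M.alphaNet i j * ∫ x in Ω, T.glue (p j) x * T.glue (q i) x
      = - ∫ x in Ω, ((M.Lambda1 + M.Lambda2) *ᵥ fun i => T.glue (p i) x) ⬝ᵥ
          fun i => T.glue (q i) x := by
  have hint : ∀ i j, Integrable (fun x => (M.Lambda1 + M.Lambda2) i j *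
      (T.glue (p j) x * T.glue (q i) x)) (volume.restrict Ω) := fun i j =>
    ((T.memLp_glue (p j)).integrable_mul (T.memLp_glue (q i))).const_mul _
  simp only [mulVec, dotProduct, Finset.sum_mul, mul_assoc]
  rw [integral_finsetSum _ fun i _ => integrable_finsetSum _ fun j _ => hint i j,
    ← Finset.sum_neg_distrib, ← Finset.sum_add_distrib]
  refine Finset.sum_congr rfl fun i _ => ?_
  rw [integral_finsetSum _ fun j _ => hint i j, ← Finset.add_sum_erase _ _ (Finset.mem_univ i),
    neg_add, ← Finset.sum_neg_distrib]
  congr 1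
  · rw [integral_const_mul]
    simp only [Params.Lambda1, Params.Lambda2, Matrix.add_apply, Matrix.of_apply, if_true,
      Matrix.diagonal_apply_eq]
    ring
  · refine Finset.sum_congr rfl fun j hj => ?_
    have h := (Finset.ne_of_mem_erase hj).symm
    rw [integral_const_mul]
    simp only [Params.Lambda1, Params.Lambda2, Matrix.add_apply, Matrix.of_apply, h, if_false,
      Matrix.diagonal_apply_ne _ h]
    ring

variable [NeZero n]

/-- The pressures are summed before Cauchy-Schwarz is applied, with weight `λ₀` on the divergence;
estimating them one by one would bring in `n`. -/
theorem abs_sum_glue_div_le (p : Fin n → ScalarField d) {w : VectorField d}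
    (hw : MemHDiv Ω (T.glueV w)) :
    |∑ i, ∫ x in Ω, T.glue (p i) x * T.div w x| ≤ √(d + 1) * (T.normP M p * T.normU M w) := by
  have hL := (div_spec hw).1
  rw [← integral_finsetSum _ fun i _ => T.integrable_glue_mul (p i) hL]
  refine (abs_integral_le_sqrt_mul_sqrt
    (integrable_mulVec_dotProduct M.Lambda (fun i => T.memLp_glue (p i))
      fun i => T.memLp_glue (p i)) (hL.integrable_sq.const_mul M.lam0)
    (fun x => mulVec_dotProduct_nonneg M.posDef_Lambda.posSemidef _)
    (fun x => mul_nonneg M.lam0_pos.le (sq_nonneg _)) fun x => ?_).trans ?_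
  · simp only [← Finset.sum_mul]
    rw [mul_pow]
    have := mul_le_mul_of_nonneg_right (M.sum_sq_le_Lambda fun i => T.glue (p i) x)
      (sq_nonneg (T.div w x))
    linarith
  · refine (mul_le_mul_of_nonneg_left (T.sqrt_lam0_div_le_normU M hw)
      (Real.sqrt_nonneg _)).trans_eq ?_
    rw [normP]; ring

theorem Lambda_inv_div_nonneg (v : Fin n → VectorField d) : 0 ≤ ∫ x in Ω,
    (M.Lambda⁻¹ *ᵥ fun i => T.div (v i) x) ⬝ᵥ fun i => T.div (v i) x :=
  integral_nonneg fun _ => mulVec_dotProduct_nonneg M.posDef_Lambda.inv.posSemidef _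

theorem abs_sum_flux_le {v z : Fin n → VectorField d} (hv : ∀ i, MemHDiv Ω (T.glueV (v i)))
    (hz : ∀ i, MemHDiv Ω (T.glueV (z i))) :
    |∑ i, ∫ x in Ω, M.Rinv i * inner ℝ (T.glueV (v i) x) (T.glueV (z i) x)|
      ≤ T.normV M v * T.normV M z := by
  have hnn : ∀ (v : Fin n → VectorField d) i x,
      0 ≤ M.Rinv i * inner ℝ (T.glueV (v i) x) (T.glueV (v i) x) :=
    fun v i x => mul_nonneg (M.Rinv_pos i).le real_inner_self_nonneg
  have hint : ∀ v : Fin n → VectorField d, (∀ i, MemHDiv Ω (T.glueV (v i))) → ∀ i,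
      Integrable (fun x => M.Rinv i * inner ℝ (T.glueV (v i) x) (T.glueV (v i) x))
        (volume.restrict Ω) := fun v hv i => by
    simp only [real_inner_self_eq_norm_sq]
    exact (hv i).1.norm.integrable_sq.const_mul _
  have hN : ∀ v : Fin n → VectorField d,
      √(∑ i, ∫ x in Ω, M.Rinv i * inner ℝ (T.glueV (v i) x) (T.glueV (v i) x)) ≤ T.normV M v :=
    fun v => Real.sqrt_le_sqrt (le_add_of_nonneg_right (T.Lambda_inv_div_nonneg M v))
  refine (abs_sum_le_sqrt_mul_sqrt Finset.univ (fun i _ => integral_nonneg (hnn v i))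
    (fun i _ => integral_nonneg (hnn z i)) fun i _ =>
      abs_integral_le_sqrt_mul_sqrt (hint v hv i) (hint z hz i) (hnn v i) (hnn z i)
        fun x => ?_).trans (mul_le_mul (hN v) (hN z) (Real.sqrt_nonneg _) (Real.sqrt_nonneg _))
  have := real_inner_mul_inner_self_le (T.glueV (v i) x) (T.glueV (z i) x)
  have := mul_le_mul_of_nonneg_left this (sq_nonneg (M.Rinv i))
  linarith

theorem abs_sum_glue_div_flux_le (p : Fin n → ScalarField d) {z : Fin n → VectorField d}
    (hz : ∀ i, MemHDiv Ω (T.glueV (z i))) :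
    |∑ i, ∫ x in Ω, T.glue (p i) x * T.div (z i) x| ≤ T.normP M p * T.normV M z := by
  have hL := fun i => (div_spec (hz i)).1
  rw [← integral_finsetSum _ fun i _ => T.integrable_glue_mul (p i) (hL i)]
  refine (abs_integral_le_sqrt_mul_sqrt
    (integrable_mulVec_dotProduct M.Lambda (fun i => T.memLp_glue (p i))
      fun i => T.memLp_glue (p i)) (integrable_mulVec_dotProduct M.Lambda⁻¹ hL hL)
    (fun x => mulVec_dotProduct_nonneg M.posDef_Lambda.posSemidef _)
    (fun x => mulVec_dotProduct_nonneg M.posDef_Lambda.inv.posSemidef _)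
    fun x => dotProduct_sq_le M.posDef_Lambda _ _).trans ?_
  exact mul_le_mul_of_nonneg_left
    (Real.sqrt_le_sqrt (le_add_of_nonneg_left (T.sum_flux_nonneg M z))) (Real.sqrt_nonneg _)

/-- Cauchy-Schwarz holds for the semidefinite form of `Λ₁ + Λ₂`, and each factor is then enlarged to
the form of `Λ`. -/
theorem abs_pressure_term_le (p q : Fin n → ScalarField d) :
    |(∑ i, (-M.alphaP i - M.alphaNet i i) * ∫ x in Ω, T.glue (p i) x * T.glue (q i) x)
      + ∑ i, ∑ j ∈ Finset.univ.erase i,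
        M.alphaNet i j * ∫ x in Ω, T.glue (p j) x * T.glue (q i) x|
      ≤ T.normP M p * T.normP M q := by
  have h12 := M.posSemidef_Lambda1.add M.posSemidef_Lambda2
  have hint := fun p : Fin n → ScalarField d => integrable_mulVec_dotProduct M.Lambda
    (fun i => T.memLp_glue (p i)) fun i => T.memLp_glue (p i)
  have hnn := fun x => mulVec_dotProduct_nonneg M.posDef_Lambda.posSemidef x
  rw [T.pressure_term_eq, abs_neg]
  refine abs_integral_le_sqrt_mul_sqrt (hint p) (hint q) (fun x => hnn _) (fun x => hnn _)
    fun x => ?_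
  exact (dotProduct_mulVec_sq_le h12 _ _).trans (mul_le_mul (M.Lambda12_le _) (M.Lambda12_le _)
    (mulVec_dotProduct_nonneg h12 _) (hnn _))

end Triangulation

theorem Family.IsLocal.totalDegree_le {F : Family} {l : ℕ} {K : Finset (Pt d)}
    {u : Fin d → MvPolynomial (Fin d) ℝ} (h : F.IsLocal l K u) (i : Fin d) :
    (u i).totalDegree ≤ l := by
  cases F
  · exact h i
  · exact h.1 i

end MPET

end

/-- Uniform boundedness of the discrete bilinear form: the constant `C` may depend on the dimension,
the domain, the degree and the family of the elements, the shape regularity constant `σ` and the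
stabilization parameter `η`, but neither on the triangulation (hence not on its mesh size) nor on
the number of networks nor on any model parameter. -/
theorem theorem4p1 (d : ℕ) (hd : d = 2 ∨ d = 3) (Ω : Set (Pt d)) (F : Family) (l : ℕ) (hl : 1 ≤ l)
    (σ η : ℝ) (hη : 0 < η) :
    ∃ C : ℝ, 0 < C ∧
      ∀ T : Triangulation d Ω, T.ShapeRegular σ →
      ∀ (n : ℕ) [NeZero n] (M : Params n)
        (u w : VectorField d) (v z : Fin n → VectorField d) (p q : Fin n → ScalarField d),
        u ∈ T.Uh F l → w ∈ T.Uh F l →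
        (∀ i, v i ∈ T.Vh l) → (∀ i, z i ∈ T.Vh l) →
        (∀ i, p i ∈ T.Ph l) → (∀ i, q i ∈ T.Ph l) →
        |T.Ah M η u v p w z q| ≤
          C * (T.normU M u + T.normV M v + T.normP M p)
            * (T.normU M w + T.normV M z + T.normP M q) := by
  obtain ⟨C, hC, hah⟩ := Triangulation.exists_abs_ah_le (d := d) (by omega) l σ hη.le
  -- `C` bounds `ah`, each of the two pressure-displacement couplings costs `√(d + 1)`, and the five
  -- units are for the `λ` term, the flux term, the two pressure-flux couplings and the pressure
  -- terms.
  refine ⟨C + 2 * √(d + 1) + 5, by positivity, ?_⟩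
  intro T hT n _ M u w v z p q hu hw hv hz _ _
  set X := T.normU M u + T.normV M v + T.normP M p with hX
  set Y := T.normU M w + T.normV M z + T.normP M q with hY
  have hU : ∀ u, 0 ≤ T.normU M u := fun _ => Real.sqrt_nonneg _
  have hV : ∀ v, 0 ≤ T.normV M v := fun _ => Real.sqrt_nonneg _
  have hP : ∀ p, 0 ≤ T.normP M p := fun _ => Real.sqrt_nonneg _
  have hX0 : 0 ≤ X := add_nonneg (add_nonneg (hU u) (hV v)) (hP p)
  have hXY : ∀ {a b : ℝ}, a ≤ X → 0 ≤ b → b ≤ Y → a * b ≤ X * Y := fun ha hb0 hb =>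
    mul_le_mul ha hb hb0 hX0
  have huX : T.normU M u ≤ X := by linarith [hV v, hP p]
  have hvX : T.normV M v ≤ X := by linarith [hU u, hP p]
  have hpX : T.normP M p ≤ X := by linarith [hU u, hV v]
  have hwY : T.normU M w ≤ Y := by linarith [hV z, hP q]
  have hzY : T.normV M z ≤ Y := by linarith [hU w, hP q]
  have hqY : T.normP M q ≤ Y := by linarith [hU w, hV z]
  have t1 : |T.ah η u w| ≤ C * (X * Y) := (hah Ω T hT u w
    (fun K hK => (hu.2.1 K hK).totalDegree_le) fun K hK => (hw.2.1 K hK).totalDegree_le).trans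
    (mul_le_mul_of_nonneg_left (hXY ((T.sqrt_dgNormSq_le_normU M u).trans huX)
      (Real.sqrt_nonneg _) ((T.sqrt_dgNormSq_le_normU M w).trans hwY)) hC)
  have t2 := (T.abs_lam_div_div_le M hu.1 hw.1).trans (hXY huX (hU w) hwY)
  have t3 := (T.abs_sum_glue_div_le M p hw.1).trans
    (mul_le_mul_of_nonneg_left (hXY hpX (hU w) hwY) (Real.sqrt_nonneg _))
  have t4 := (T.abs_sum_flux_le M (fun i => (hv i).1) fun i => (hz i).1).trans
    (hXY hvX (hV z) hzY)
  have t5 := (T.abs_sum_glue_div_flux_le M p fun i => (hz i).1).trans (hXY hpX (hV z) hzY)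
  have t6 := (T.abs_sum_glue_div_le M q hu.1).trans (mul_le_mul_of_nonneg_left
    ((mul_comm _ _).trans_le (hXY huX (hP q) hqY)) (Real.sqrt_nonneg _))
  have t7 := (T.abs_sum_glue_div_flux_le M q fun i => (hv i).1).trans
    ((mul_comm _ _).trans_le (hXY hvX (hP q) hqY))
  have t8 := (T.abs_pressure_term_le M p q).trans (hXY hpX (hP q) hqY)
  simp only [mul_comm (T.glue (q _) _)] at t6 t7
  rw [abs_le] at t1 t2 t3 t4 t5 t6 t7 t8
  rw [Triangulation.Ah, abs_le, mul_assoc]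
  constructor <;> linarith
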